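/- Let $a_1$, $a_2$ and $a_3$ be positive integers and let $A$ be a positive common multiple of $a_1$, $a_2$ and $a_3$. Let $g_1=\gcd(a_2,a_3)$, $g_2=\gcd(a_3,a_1)$, $g_3=\gcd(a_1,a_2)$ and $g=\gcd(a_1,a_2,a_3)$. Then for any odd prime $p$ dividing none of $a_1$, $a_2$, $a_3$, and any positive integer $r$, $$\sum_{\substack{i,j,k\ge 1\\ \gcd(ijk,p)=1\\ a_1 i+a_2 j+a_3 k=Ap^r}}\frac{1}{ijk}\equiv -2p^{r-1}B_{p-3}\cdot \frac{Ag^3}{3}\left(\frac{1}{a_1^2 g_1^2}+\frac{1}{a_2^2 g_2^2}+\frac{1}{a_3^2 g_3^2}\right) \pmod{p^r}.$$ Here $B_n$ is the $n$-th Bernoulli number, defined by $\frac{z}{e^z-1}=\sum_{n\ge 0}\frac{B_n z^n}{n!}$. The congruence is between $p$-integral rational numbers (rational numbers whose reduced denominator is not divisible by $p$): both sides are $p$-integral, and their difference is $p^r$ times a $p$-integral rational number. -/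

import Mathlib

/-- The rational number `x` is `p`-integral: it lies in the localization of `ℤ` at the prime `p`,
that is, `p` does not divide its reduced denominator. -/
def PIntegral (p : ℕ) (x : ℚ) : Prop := ¬ p ∣ x.den

/-- `x ≡ y (mod p ^ r)` in the ring of `p`-integral rational numbers: both sides are `p`-integral,
and their difference is `p ^ r` times a `p`-integral rational number. -/
def PCongr (p r : ℕ) (x y : ℚ) : Prop :=
  PIntegral p x ∧ PIntegral p y ∧ ∃ t : ℚ, PIntegral p t ∧ x - y = (p : ℚ) ^ r * t

/-- The triples `(i, j, k)` of positive integers with `gcd(ijk, p) = 1` and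
`a₁ i + a₂ j + a₃ k = N`. For positive coefficients the bounds `i, j, k ≤ N` are automatic
(see `mem_solutions`), and serve only to make the set visibly finite. -/
def solutions (a₁ a₂ a₃ N p : ℕ) : Finset (ℕ × ℕ × ℕ) :=
  (Finset.Icc 1 N ×ˢ Finset.Icc 1 N ×ˢ Finset.Icc 1 N).filter fun x =>
    Nat.gcd (x.1 * x.2.1 * x.2.2) p = 1 ∧ a₁ * x.1 + a₂ * x.2.1 + a₃ * x.2.2 = N

theorem mem_solutions {a₁ a₂ a₃ N p : ℕ} (h₁ : 0 < a₁) (h₂ : 0 < a₂) (h₃ : 0 < a₃)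
    (i j k : ℕ) :
    (i, j, k) ∈ solutions a₁ a₂ a₃ N p ↔
      1 ≤ i ∧ 1 ≤ j ∧ 1 ≤ k ∧ Nat.gcd (i * j * k) p = 1 ∧ a₁ * i + a₂ * j + a₃ * k = N := by
  have e₁ := Nat.le_mul_of_pos_left i h₁
  have e₂ := Nat.le_mul_of_pos_left j h₂
  have e₃ := Nat.le_mul_of_pos_left k h₃
  simp only [solutions, Finset.mem_filter, Finset.mem_product, Finset.mem_Icc]
  constructor
  · rintro ⟨⟨⟨hi, -⟩, ⟨hj, -⟩, hk, -⟩, hg, he⟩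
    exact ⟨hi, hj, hk, hg, he⟩
  · rintro ⟨hi, hj, hk, hg, he⟩
    exact ⟨⟨⟨hi, by omega⟩, ⟨hj, by omega⟩, hk, by omega⟩, hg, he⟩

/-- The sum of `1 / (ijk)` over all positive integers `i`, `j`, `k` with `gcd(ijk, p) = 1` and
`a₁ i + a₂ j + a₃ k = N`. -/
def reciprocalSum (a₁ a₂ a₃ N p : ℕ) : ℚ :=
  ∑ x ∈ solutions a₁ a₂ a₃ N p, 1 / ((x.1 : ℚ) * (x.2.1 : ℚ) * (x.2.2 : ℚ))

/-! Put u = a₁i, v = a₂j, w = a₃k. The sum becomes a₁a₂a₃ times the sum of 1/(uvw) over u + v + w =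
Ap^r with p ∤ uvw and a₁ ∣ u, a₂ ∣ v, a₃ ∣ w. Let T(N) be this inner sum at total N, let L = lcm(a₁,
a₂, a₃), and let A = mL.

Dilation. Let pL ∣ N. In T(nN) each variable is x + Nα with x < N, and 1/(x + Nα) ≡ (1/x)(1 − Nα/x)
mod N². The residues x, y, z add up to N or 2N, and x ↦ N − x shows that the layer 2N contributes
−T(N) mod N. Counting the triples (α, β, γ) gives T(nN) ≡ nT(N) mod N, and mod pN when n = p
(`dvd_recipSum_nat_mul_sub`, `dvd_recipSum_prime_mul_sub`). Hence T(Ap^r) ≡ m p^(r−1) T(pL) mod p^r.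

Base. Modulo p, 1/x may be replaced by τ(x), the inverse Teichmüller character. Since τ is exactly
odd and multiplicative, p times the new sum equals J·E·S, with J = ∑ τ(s)τ(1+s), E = ∑ x τ(x)³ and S
an explicit gcd expression (`p_mul_boxSum_teichOn`). Here J ≡ 2 mod p and, for p > 3, 3E ≡ −pB_{p−3}
mod p² (`dvd_three_mul_weightedCubeSum_add`), so 3T(pL) ≡ −2B_{p−3}S mod p. For p = 3 the
denominator 3 costs one more power of p; there J = E = −1 and B₀ = 1, and a computation mod 9
suffices. -/

namespace WeightedTripleSum
open Finset

/-! ### Reflection of a box -/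

/-- The sum of `f x * g y * h z` over the triples `x, y, z < N` with `x + y + z = s`. -/
def boxSum {R : Type*} [CommRing R] (f g h : ℕ → R) (N s : ℕ) : R :=
  ∑ x ∈ range N, ∑ y ∈ range N, ∑ z ∈ range N, if x + y + z = s then f x * g y * h z else 0

/-- The reduction mod N makes the reflection an involution of all of [0, N), fixing 0. -/
theorem sum_range_neg_mod {R : Type*} [AddCommMonoid R] (N : ℕ) (φ : ℕ → R) :
    ∑ x ∈ range N, φ x = ∑ x ∈ range N, φ ((N - x) % N) := by
  have key : ∀ x ∈ range N, (N - x) % N ∈ range N ∧ (N - (N - x) % N) % N = x := by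
    intro x hx
    rw [mem_range] at hx
    rcases Nat.eq_zero_or_pos x with rfl | h0
    · simp [hx]
    · have : (N - x) % N = N - x := Nat.mod_eq_of_lt (by omega)
      rw [this, mem_range]
      exact ⟨by omega, by rw [Nat.sub_sub_self hx.le, Nat.mod_eq_of_lt hx]⟩
  exact sum_nbij' (fun x => (N - x) % N) (fun x => (N - x) % N) (fun x hx => (key x hx).1)
    (fun x hx => (key x hx).1) (fun x hx => (key x hx).2) (fun x hx => (key x hx).2)
    (fun x hx => by rw [(key x hx).2])

/-- Reflecting all three variables exchanges the totals N and 2N. Each factor is odd modulo d, so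
the product of three changes sign. -/
theorem dvd_boxSum_add_boxSum_two_mul {R : Type*} [CommRing R] {f g h : ℕ → R} {N : ℕ} {d : R}
    (hf0 : f 0 = 0) (hg0 : g 0 = 0) (hh0 : h 0 = 0)
    (hf : ∀ x, 0 < x → x < N → d ∣ f x + f (N - x))
    (hg : ∀ x, 0 < x → x < N → d ∣ g x + g (N - x))
    (hh : ∀ x, 0 < x → x < N → d ∣ h x + h (N - x)) :
    d ∣ boxSum f g h N N + boxSum f g h N (2 * N) := by
  have e : boxSum f g h N (2 * N) = ∑ x ∈ range N, ∑ y ∈ range N, ∑ z ∈ range N,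
      if (N - x) % N + (N - y) % N + (N - z) % N = 2 * N then
        f ((N - x) % N) * g ((N - y) % N) * h ((N - z) % N) else 0 := by
    rw [boxSum, sum_range_neg_mod]
    refine sum_congr rfl fun x _ => ?_
    rw [sum_range_neg_mod]
    refine sum_congr rfl fun y _ => ?_
    rw [sum_range_neg_mod]
  rw [e, boxSum, ← sum_add_distrib]
  refine dvd_sum fun x hx => ?_
  rw [← sum_add_distrib]
  refine dvd_sum fun y hy => ?_
  rw [← sum_add_distrib]
  refine dvd_sum fun z hz => ?_
  rw [mem_range] at hx hy hz
  rcases Nat.eq_zero_or_pos x with rfl | x0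
  · simp [hf0]
  rcases Nat.eq_zero_or_pos y with rfl | y0
  · simp [hg0]
  rcases Nat.eq_zero_or_pos z with rfl | z0
  · simp [hh0]
  rw [Nat.mod_eq_of_lt (by omega : N - x < N), Nat.mod_eq_of_lt (by omega : N - y < N),
    Nat.mod_eq_of_lt (by omega : N - z < N)]
  by_cases hs : x + y + z = N
  · rw [if_pos hs, if_pos (by omega)]
    obtain ⟨a, ha⟩ := hf x x0 hx
    obtain ⟨b, hb⟩ := hg y y0 hy
    obtain ⟨c, hc⟩ := hh z z0 hz
    rw [eq_sub_of_add_eq' ha, eq_sub_of_add_eq' hb, eq_sub_of_add_eq' hc]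
    refine ⟨d ^ 2 * a * b * c - d * a * b * h z - d * a * c * g y - d * b * c * f x
      + a * g y * h z + b * f x * h z + c * f x * g y, by ring⟩
  · rw [if_neg hs, if_neg (by omega), add_zero]
    exact dvd_zero d

/-! ### Dilation of a box and simplex counts -/

theorem sum_range_mul {R : Type*} [AddCommMonoid R] (m N : ℕ) (φ : ℕ → R) :
    ∑ u ∈ range (m * N), φ u = ∑ x ∈ range N, ∑ α ∈ range m, φ (x + N * α) := by
  rw [sum_comm]
  induction m with
  | zero => simp
  | succ m ih =>
    rw [Nat.succ_mul, sum_range_add, ih, sum_range_succ]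
    congr 1
    exact sum_congr rfl fun x _ => by rw [add_comm, mul_comm]

/-- The sum of `w α β γ` over the triples `α, β, γ < m` with `α + β + γ = n`. -/
def simplexSum {R : Type*} [AddCommMonoid R] (m n : ℕ) (w : ℕ → ℕ → ℕ → R) : R :=
  ∑ α ∈ range m, ∑ β ∈ range m, ∑ γ ∈ range m, if α + β + γ = n then w α β γ else 0

/-- A fixed α ≤ n leaves n + 1 − α pairs (β, γ); n < m makes the bounds by m automatic, and
truncated subtraction kills α > n. -/
theorem simplexSum_fst {m n : ℕ} (hn : n < m) (φ : ℕ → ℕ) :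
    simplexSum m n (fun α _ _ => φ α) = ∑ α ∈ range (n + 1), φ α * (n + 1 - α) := by
  have h1 : ∀ α β, (∑ γ ∈ range m, if α + β + γ = n then φ α else 0)
      = if β ∈ range (n + 1 - α) then φ α else 0 := by
    intro α β
    split_ifs with h
    · rw [mem_range] at h
      rw [sum_eq_single (n - α - β)]
      · rw [if_pos (by omega)]
      · intro γ _ hγ
        rw [if_neg (by omega)]
      · intro h'
        exact absurd (mem_range.2 (by omega)) h'
    · rw [mem_range] at h
      exact sum_eq_zero fun γ _ => if_neg (by omega)
  have h2 : ∀ α, (∑ β ∈ range m, if β ∈ range (n + 1 - α) then φ α else 0)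
      = φ α * (n + 1 - α) := by
    intro α
    rw [← sum_filter, filter_mem_eq_inter, sum_const, inter_eq_right.2, card_range, smul_eq_mul,
      mul_comm]
    exact range_subset_range.2 (by omega)
  simp only [simplexSum, h1, h2]
  refine (sum_subset (range_subset_range.2 hn) fun α _ hα => ?_).symm
  rw [mem_range] at hα
  rw [show n + 1 - α = 0 by omega, mul_zero]

theorem simplexSum_one {m n : ℕ} (hn : n < m) :
    simplexSum m n (fun _ _ _ => 1) = (n + 2).choose 2 := by
  rw [simplexSum_fst hn (fun _ => 1)]
  clear hn
  induction n with
  | zero => simp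
  | succ n ih =>
    rw [sum_range_succ', Nat.choose_succ_succ' (n + 2), ← ih]
    simp only [Nat.add_sub_add_right, Nat.choose_one_right]
    omega

theorem simplexSum_id {m n : ℕ} (hn : n < m) :
    simplexSum m n (fun α _ _ => α) = (n + 2).choose 3 := by
  rw [simplexSum_fst hn (fun α => α)]
  clear hn
  induction n with
  | zero => simp
  | succ n ih =>
    have h := simplexSum_fst (Nat.lt_succ_self n) (fun _ => 1)
    rw [simplexSum_one (Nat.lt_succ_self n)] at h
    rw [sum_range_succ', Nat.choose_succ_succ' (n + 2), ← ih, h, ← sum_add_distrib]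
    simp only [Nat.add_sub_add_right]
    simp only [zero_mul, add_zero]
    exact sum_congr rfl fun α _ => by ring

theorem simplexSum_swap_left {R : Type*} [AddCommMonoid R] (m n : ℕ) (w : ℕ → ℕ → ℕ → R) :
    simplexSum m n w = simplexSum m n (fun β α γ => w α β γ) := by
  rw [simplexSum, sum_comm]
  refine sum_congr rfl fun β _ => sum_congr rfl fun α _ => sum_congr rfl fun γ _ => ?_
  rw [add_comm α β]

theorem simplexSum_swap_right {R : Type*} [AddCommMonoid R] (m n : ℕ) (w : ℕ → ℕ → ℕ → R) :
    simplexSum m n w = simplexSum m n (fun α γ β => w α β γ) := by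
  refine sum_congr rfl fun α _ => ?_
  rw [sum_comm]
  refine sum_congr rfl fun β _ => sum_congr rfl fun γ _ => ?_
  rw [add_right_comm α γ β]

theorem natCast_simplexSum {R : Type*} [CommRing R] (m n : ℕ) (w : ℕ → ℕ → ℕ → ℕ) :
    ((simplexSum m n w : ℕ) : R) = simplexSum m n (fun α β γ => (w α β γ : R)) := by
  simp [simplexSum]

theorem simplexSum_affine {R : Type*} [CommRing R] {m n : ℕ} (hn : n < m) (c a₁ a₂ a₃ : R) :
    simplexSum m n (fun α β γ => c * (1 + (a₁ * α + a₂ * β + a₃ * γ)))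
      = c * ((n + 2).choose 2 + (n + 2).choose 3 * (a₁ + a₂ + a₃)) := by
  have e0 : simplexSum m n (fun _ _ _ => (1 : R)) = (n + 2).choose 2 := by
    rw [← simplexSum_one hn, natCast_simplexSum]
    simp
  have e1 : simplexSum m n (fun α _ _ => (α : R)) = (n + 2).choose 3 := by
    rw [← simplexSum_id hn, natCast_simplexSum]
  have e2 : simplexSum m n (fun _ β _ => (β : R)) = (n + 2).choose 3 := by
    rw [simplexSum_swap_left, e1]
  have e3 : simplexSum m n (fun _ _ γ => (γ : R)) = (n + 2).choose 3 := by
    rw [simplexSum_swap_right, e2]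
  have key : simplexSum m n (fun α β γ => c * (1 + (a₁ * α + a₂ * β + a₃ * γ)))
      = c * (simplexSum m n (fun _ _ _ => (1 : R)) + (a₁ * simplexSum m n (fun α _ _ => (α : R))
        + a₂ * simplexSum m n (fun _ β _ => (β : R))
        + a₃ * simplexSum m n (fun _ _ γ => (γ : R)))) := by
    simp only [simplexSum, mul_sum, ← sum_add_distrib]
    refine sum_congr rfl fun α _ => sum_congr rfl fun β _ => sum_congr rfl fun γ _ => ?_
    split_ifs <;> simp
  rw [key, e0, e1, e2, e3]
  ring

/-- Sums over dilated boxes: if `f (x + N α) ≡ f x (1 + e α ψ x)` and likewise for `g`, `h`, and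
the terms linear in `e` vanish modulo `D`, then the sum over the box of side `m N` is a combination
of the two sums over the box of side `N`. -/
theorem dvd_boxSum_mul_sub {R : Type*} [CommRing R] {f g h ψ : ℕ → R} {N m : ℕ} {D e : R}
    (hm : 0 < m) (hf0 : f 0 = 0) (hg0 : g 0 = 0) (hh0 : h 0 = 0) (he : D ∣ e * e)
    (hf : ∀ x α, D ∣ f (x + N * α) - f x * (1 + e * ψ x * α))
    (hg : ∀ x α, D ∣ g (x + N * α) - g x * (1 + e * ψ x * α))
    (hh : ∀ x α, D ∣ h (x + N * α) - h x * (1 + e * ψ x * α))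
    (h1 : ∀ x y z, x + y + z = N → f x * g y * h z ≠ 0 →
      D ∣ ((m + 1).choose 3 : R) * (e * ψ x + e * ψ y + e * ψ z))
    (h2 : ∀ x y z, x + y + z = 2 * N → f x * g y * h z ≠ 0 →
      D ∣ (m.choose 3 : R) * (e * ψ x + e * ψ y + e * ψ z)) :
    D ∣ boxSum f g h (m * N) (m * N) - (((m + 1).choose 2 : R) * boxSum f g h N N
      + (m.choose 2 : R) * boxSum f g h N (2 * N)) := by
  have expand : boxSum f g h (m * N) (m * N) = ∑ x ∈ range N, ∑ y ∈ range N, ∑ z ∈ range N,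
      ∑ α ∈ range m, ∑ β ∈ range m, ∑ γ ∈ range m,
        if x + y + z + N * (α + β + γ) = m * N then
          f (x + N * α) * g (y + N * β) * h (z + N * γ) else 0 := by
    rw [boxSum, sum_range_mul]
    refine sum_congr rfl fun x _ => ?_
    simp only [sum_range_mul m N]
    rw [sum_comm]
    refine sum_congr rfl fun y _ => ?_
    rw [sum_congr rfl fun α _ => sum_comm, sum_comm]
    refine sum_congr rfl fun z _ => sum_congr rfl fun α _ => sum_congr rfl fun β _ =>
      sum_congr rfl fun γ _ => ?_
    rw [show x + N * α + (y + N * β) + (z + N * γ) = x + y + z + N * (α + β + γ) by ring]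
  rw [expand]
  simp only [boxSum, mul_sum, ← sum_add_distrib, ← sum_sub_distrib]
  refine dvd_sum fun x hx => dvd_sum fun y hy => dvd_sum fun z hz => ?_
  rw [mem_range] at hx hy hz
  have main : D ∣ (∑ α ∈ range m, ∑ β ∈ range m, ∑ γ ∈ range m,
      if x + y + z + N * (α + β + γ) = m * N then
        f (x + N * α) * g (y + N * β) * h (z + N * γ) else 0) -
      ∑ α ∈ range m, ∑ β ∈ range m, ∑ γ ∈ range m,
      if x + y + z + N * (α + β + γ) = m * N then
        f x * g y * h z * (1 + (e * ψ x * α + e * ψ y * β + e * ψ z * γ)) else 0 := by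
    simp only [← sum_sub_distrib]
    refine dvd_sum fun α _ => dvd_sum fun β _ => dvd_sum fun γ _ => ?_
    split_ifs
    · obtain ⟨a, ha⟩ := hf x α
      obtain ⟨b, hb⟩ := hg y β
      obtain ⟨c, hc⟩ := hh z γ
      obtain ⟨k, hk⟩ := he
      rw [eq_add_of_sub_eq ha, eq_add_of_sub_eq hb, eq_add_of_sub_eq hc]
      -- Every term beyond the linear ones contains e², which D divides.
      have : f x * g y * h z * ((1 + e * ψ x * α) * (1 + e * ψ y * β) * (1 + e * ψ z * γ)
          - (1 + (e * ψ x * α + e * ψ y * β + e * ψ z * γ)))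
          = D * (k * (f x * g y * h z * (ψ x * α * (ψ y * β) + ψ x * α * (ψ z * γ)
            + ψ y * β * (ψ z * γ) + e * (ψ x * α) * (ψ y * β) * (ψ z * γ)))) := by
        linear_combination (f x * g y * h z * (ψ x * α * (ψ y * β) + ψ x * α * (ψ z * γ)
            + ψ y * β * (ψ z * γ) + e * (ψ x * α) * (ψ y * β) * (ψ z * γ))) * hk
      set X := f x * (1 + e * ψ x * α)
      set Y := g y * (1 + e * ψ y * β)
      set Z := h z * (1 + e * ψ z * γ)
      refine (dvd_add (b := (D * a + X) * (D * b + Y) * (D * c + Z) - X * Y * Z)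
        (c := X * Y * Z - f x * g y * h z * (1 + (e * ψ x * α + e * ψ y * β + e * ψ z * γ)))
        ⟨D ^ 2 * a * b * c + D * (a * b * Z + a * c * Y + b * c * X) + a * Y * Z + b * X * Z
          + c * X * Y, by ring⟩ ⟨_, Eq.trans (by simp only [X, Y, Z]; ring) this⟩).trans
        (dvd_of_eq (by ring))
    · simp
  suffices h : D ∣ (∑ α ∈ range m, ∑ β ∈ range m, ∑ γ ∈ range m,
      if x + y + z + N * (α + β + γ) = m * N then
        f x * g y * h z * (1 + (e * ψ x * α + e * ψ y * β + e * ψ z * γ)) else 0) -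
      (((m + 1).choose 2 : R) * (if x + y + z = N then f x * g y * h z else 0)
        + (m.choose 2 : R) * (if x + y + z = 2 * N then f x * g y * h z else 0)) by
    have := dvd_add main h
    rwa [sub_add_sub_cancel] at this
  by_cases hc : f x * g y * h z = 0
  · simp [hc]
  have x0 : 0 < x := Nat.pos_of_ne_zero fun h => hc (by rw [h, hf0, zero_mul, zero_mul])
  have y0 : 0 < y := Nat.pos_of_ne_zero fun h => hc (by rw [h, hg0, mul_zero, zero_mul])
  have z0 : 0 < z := Nat.pos_of_ne_zero fun h => hc (by rw [h, hh0, mul_zero])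
  have hN : 0 < N := x0.trans hx
  obtain ⟨n, rfl⟩ : ∃ n, m = n + 1 := ⟨m - 1, by omega⟩
  by_cases s1 : x + y + z = N
  -- On the layer N the shifts satisfy α + β + γ = m − 1.
  · have hcond : ∀ t, x + y + z + N * t = (n + 1) * N ↔ t = n := by
      intro t
      rw [s1, mul_comm (n + 1), mul_add, mul_one, add_comm, Nat.add_right_cancel_iff,
        Nat.mul_right_inj hN.ne']
    have := simplexSum_affine (Nat.lt_succ_self n) (f x * g y * h z) (e * ψ x) (e * ψ y) (e * ψ z)
    simp only [hcond]
    rw [simplexSum] at this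
    rw [this, if_pos s1, if_neg (by omega)]
    obtain ⟨k, hk⟩ := h1 x y z s1 hc
    exact ⟨f x * g y * h z * k, by linear_combination (f x * g y * h z) * hk⟩
  by_cases s2 : x + y + z = 2 * N
  -- On the layer 2N the shifts add up to m − 2; for m = 1 there are none, and `choose 1 2` is 0.
  · rcases n with _ | n
    · have hcond : ∀ t, ¬ x + y + z + N * t = (0 + 1) * N := by
        intro t
        rw [s2]
        nlinarith [Nat.zero_le (N * t)]
      simp only [hcond, s1]
      simp
    have hcond : ∀ t, x + y + z + N * t = (n + 1 + 1) * N ↔ t = n := by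
      intro t
      rw [s2, show (n + 1 + 1) * N = 2 * N + N * n by ring, Nat.add_left_cancel_iff,
        Nat.mul_right_inj hN.ne']
    have := simplexSum_affine (show n < n + 1 + 1 by omega)
      (f x * g y * h z) (e * ψ x) (e * ψ y) (e * ψ z)
    simp only [hcond]
    rw [simplexSum] at this
    rw [this, if_pos s2, if_neg s1]
    obtain ⟨k, hk⟩ := h2 x y z s2 hc
    exact ⟨f x * g y * h z * k, by linear_combination (f x * g y * h z) * hk⟩
  · have hcond : ∀ t, ¬ x + y + z + N * t = (n + 1) * N := by
      intro t ht
      have hd : N ∣ x + y + z := by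
        rw [← Nat.dvd_add_left (Dvd.intro t rfl), ht]
        exact Dvd.intro_left _ rfl
      obtain ⟨k, hk⟩ := hd
      have hk3 : k < 3 := by
        by_contra h3
        have := Nat.mul_le_mul_left N (not_lt.1 h3)
        omega
      interval_cases k <;> omega
    simp [hcond, s1, s2]

/-! ### The inverse Teichmüller character -/

section Teichmuller
variable (p : ℕ) [Fact p.Prime]

/-- Every p-adic integer is a natural number plus a multiple of p, so there is only one such map.
This identifies the constant Witt coefficient with reduction mod p. -/
theorem ringHom_padicInt_zmod (f : ℤ_[p] →+* ZMod p) (x : ℤ_[p]) : f x = PadicInt.toZMod x := by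
  have hx := x.sub_zmodRepr_mem
  rw [PadicInt.maximalIdeal_eq_span_p, Ideal.mem_span_singleton] at hx
  obtain ⟨c, hc⟩ := hx
  rw [eq_add_of_sub_eq hc]
  simp

/-- The inverse of the Teichmüller character, extended by `0`. -/
noncomputable def teichInv : ZMod p →*₀ ℤ_[p] where
  toFun x := WittVector.equiv p (WittVector.teichmuller p x⁻¹)
  map_zero' := by simp
  map_one' := by simp
  map_mul' x y := by rw [mul_inv, map_mul, map_mul]

theorem toZMod_teichInv (x : ZMod p) : PadicInt.toZMod (teichInv p x) = x⁻¹ := by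
  have h := ringHom_padicInt_zmod p
    ((WittVector.constantCoeff (p := p) (R := ZMod p)).comp
      (WittVector.equiv p).symm.toRingHom) (teichInv p x)
  rw [← h]
  simp [teichInv]

variable {p}

theorem toZMod_eq_zero_iff (x : ℤ_[p]) : PadicInt.toZMod x = 0 ↔ (p : ℤ_[p]) ∣ x := by
  rw [← RingHom.mem_ker, PadicInt.ker_toZMod, PadicInt.maximalIdeal_eq_span_p,
    Ideal.mem_span_singleton]

theorem teichInv_neg (hp : p ≠ 2) (x : ZMod p) : teichInv p (-x) = -teichInv p x := by
  have h1 : teichInv p (-1) = -1 := by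
    have h2 : teichInv p (-1) * teichInv p (-1) = 1 := by
      rw [← map_mul]
      simp
    rcases mul_self_eq_one_iff.1 h2 with h | h
    · have h3 := toZMod_teichInv p (-1)
      rw [h, map_one, inv_neg, inv_one] at h3
      have : Fact (2 < p) := ⟨lt_of_le_of_ne (Fact.out : p.Prime).two_le hp.symm⟩
      exact absurd h3.symm ZMod.neg_one_ne_one
    · exact h
  rw [← neg_one_mul, map_mul, h1, neg_one_mul]

end Teichmuller

/-! ### Sums of periodic functions and the Chinese remainder theorem -/

section PeriodicSums
variable {R : Type*} [CommRing R]

theorem sum_range_natCast_zmod (p : ℕ) [NeZero p] (φ : ZMod p → R) :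
    ∑ α ∈ range p, φ α = ∑ s, φ s := by
  refine sum_nbij' (fun α => (α : ZMod p)) (fun s => s.val) (fun _ _ => mem_univ _)
    (fun s _ => mem_range.2 s.val_lt) (fun α hα => ZMod.val_cast_of_lt (mem_range.1 hα))
    (fun s _ => ZMod.natCast_zmod_val s) fun _ _ => rfl

/-- As L is invertible mod p, for each v the map α ↦ v + Lα runs once through all residues mod p. -/
theorem sum_range_mul_of_coprime {L p : ℕ} [Fact p.Prime] (hLp : ¬ p ∣ L) (φ : ℕ → R)
    (hφ : ∀ v α, φ (v + L * α) = φ v) (χ : ZMod p → R) :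
    ∑ y ∈ range (p * L), φ y * χ y = (∑ y ∈ range L, φ y) * ∑ s, χ s := by
  have hL : (L : ZMod p) ≠ 0 := fun h => hLp ((ZMod.natCast_eq_zero_iff L p).1 h)
  rw [sum_range_mul, sum_mul]
  refine sum_congr rfl fun v _ => ?_
  simp only [hφ, ← mul_sum]
  congr 1
  push_cast
  rw [sum_range_natCast_zmod p (fun α => χ (v + L * α))]
  exact Fintype.sum_equiv ((Equiv.mulLeft₀ (L : ZMod p) hL).trans (Equiv.addLeft (v : ZMod p)))
    _ _ fun α => rfl

theorem sum_range_ite_dvd {d : ℕ} (hd : 0 < d) (k : ℕ) (φ : ℕ → R) :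
    (∑ x ∈ range (k * d), if d ∣ x then φ x else 0) = ∑ s ∈ range k, φ (d * s) := by
  rw [sum_range_mul, sum_eq_single 0]
  · simp
  · intro v hv hv0
    refine sum_eq_zero fun α _ => if_neg ?_
    rw [Nat.dvd_add_left (Dvd.intro α rfl)]
    exact Nat.not_dvd_of_pos_of_lt (Nat.pos_of_ne_zero hv0) (mem_range.1 hv)
  · intro h
    exact absurd (mem_range.2 hd) h

theorem sum_range_ite_modEq {l : ℕ} (hl : 0 < l) (k v : ℕ) :
    (∑ y ∈ range (k * l), if y ≡ v [MOD l] then (1 : R) else 0) = k := by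
  rw [sum_range_mul, sum_eq_single (v % l)]
  · simp [Nat.ModEq]
  · intro w hw hwv
    refine sum_eq_zero fun α _ => if_neg fun h => hwv ?_
    have h' : w % l = v % l := by simpa [Nat.ModEq] using h
    rwa [Nat.mod_eq_of_lt (mem_range.1 hw)] at h'
  · intro h
    exact absurd (mem_range.2 (Nat.mod_lt _ hl)) h

/-- The two congruences on y are compatible exactly when gcd(b, c) ∣ x, and then they fix one class
mod lcm(b, c). -/
theorem sum_range_ite_dvd_and_dvd {b c L : ℕ} (hb : 0 < b) (hc : 0 < c) (hbL : b ∣ L) (hcL : c ∣ L)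
    (x : ℕ) : (∑ y ∈ range L, if b ∣ y ∧ c ∣ x + y then (1 : R) else 0)
      = if b.gcd c ∣ x then ((L / b.lcm c : ℕ) : R) else 0 := by
  have hl : 0 < b.lcm c := Nat.lcm_pos hb hc
  split_ifs with hx
  · obtain ⟨w, hw⟩ : ∃ w, c ∣ x + w := ⟨c * x - x, by
      rw [Nat.add_sub_cancel' (Nat.le_mul_of_pos_left x hc)]
      exact Dvd.intro _ rfl⟩
    have hw0 : 0 ≡ w [MOD b.gcd c] := by
      refine (Nat.modEq_zero_iff_dvd.2 ?_).symm
      exact (Nat.dvd_add_right hx).1 ((Nat.gcd_dvd_right b c).trans hw)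
    obtain ⟨v, hv1, hv2⟩ := Nat.chineseRemainder' hw0
    have hiff : ∀ y, (b ∣ y ∧ c ∣ x + y) ↔ y ≡ v [MOD b.lcm c] := by
      intro y
      have e1 : b ∣ y ↔ y ≡ v [MOD b] :=
        ⟨fun h => (Nat.modEq_zero_iff_dvd.2 h).trans hv1.symm,
          fun h => Nat.modEq_zero_iff_dvd.1 (h.trans hv1)⟩
      have e2 : c ∣ x + y ↔ y ≡ v [MOD c] := by
        constructor
        · intro h
          exact (Nat.ModEq.add_left_cancel' x ((Nat.modEq_zero_iff_dvd.2 h).trans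
            (Nat.modEq_zero_iff_dvd.2 hw).symm)).trans hv2.symm
        · intro h
          exact Nat.modEq_zero_iff_dvd.1 (((h.trans hv2).add_left x).trans
            (Nat.modEq_zero_iff_dvd.2 hw))
      rw [e1, e2]
      simp only [← Int.natCast_modEq_iff, Int.modEq_and_modEq_iff_modEq_lcm]
      rfl
    simp only [hiff]
    obtain ⟨k, rfl⟩ := Nat.lcm_dvd hbL hcL
    rw [Nat.mul_div_cancel_left _ hl, mul_comm, sum_range_ite_modEq hl]
  · refine sum_eq_zero fun y _ => if_neg fun h => hx ?_
    exact (Nat.dvd_add_left ((Nat.gcd_dvd_left b c).trans h.1)).1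
      ((Nat.gcd_dvd_right b c).trans h.2)

end PeriodicSums

/-! ### Exact evaluation of the Teichmüller triple sum -/

/-- The character sum `∑ₓ x τ(x)³` over residues `x`, with `τ` the inverse Teichmüller character. -/
noncomputable def weightedCubeSum (p : ℕ) [Fact p.Prime] : ℤ_[p] :=
  ∑ x ∈ range p, (x : ℤ_[p]) * teichInv p x ^ 3

/-- The sum `∑ₛ τ(s) τ(1 + s)`, a Jacobi sum up to sign. -/
noncomputable def teichJacobi (p : ℕ) [Fact p.Prime] : ℤ_[p] :=
  ∑ s : ZMod p, teichInv p s * teichInv p (1 + s)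

/-- The function `u ↦ τ(u)` restricted to multiples of `a`. -/
noncomputable def teichOn (p : ℕ) [Fact p.Prime] (a u : ℕ) : ℤ_[p] :=
  if a ∣ u then teichInv p u else 0

/-- The sum of `w x y z` over the triples `x, y, z < N` with `N ∣ x + y + z`. -/
def modSum {R : Type*} [CommRing R] (N : ℕ) (w : ℕ → ℕ → ℕ → R) : R :=
  ∑ x ∈ range N, ∑ y ∈ range N, ∑ z ∈ range N, if N ∣ x + y + z then w x y z else 0

theorem modSum_swap_left {R : Type*} [CommRing R] (N : ℕ) (w : ℕ → ℕ → ℕ → R) :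
    modSum N w = modSum N (fun y x z => w x y z) := by
  rw [modSum, sum_comm]
  refine sum_congr rfl fun β _ => sum_congr rfl fun α _ => sum_congr rfl fun γ _ => ?_
  rw [add_comm α β]

theorem modSum_swap_right {R : Type*} [CommRing R] (N : ℕ) (w : ℕ → ℕ → ℕ → R) :
    modSum N w = modSum N (fun x z y => w x y z) := by
  refine sum_congr rfl fun α _ => ?_
  rw [sum_comm]
  refine sum_congr rfl fun β _ => sum_congr rfl fun γ _ => ?_
  rw [add_right_comm α γ β]

/-- The weight x + y + z separates the layers N and 2N. For odd functions the unweighted sum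
cancels, while this one is −N times the layer N. -/
theorem modSum_add_mul {R : Type*} [CommRing R] (N : ℕ) {f g h : ℕ → R}
    (hf0 : f 0 = 0) :
    modSum N (fun x y z => ((x : R) + y + z) * (f x * g y * h z))
      = N * boxSum f g h N N + 2 * N * boxSum f g h N (2 * N) := by
  simp only [modSum, boxSum, mul_sum, ← sum_add_distrib]
  refine sum_congr rfl fun x hx => sum_congr rfl fun y hy => sum_congr rfl fun z hz => ?_
  rw [mem_range] at hx hy hz
  by_cases hc : f x * g y * h z = 0
  · simp [hc]
  have x0 : 0 < x := Nat.pos_of_ne_zero fun h => hc (by rw [h, hf0, zero_mul, zero_mul])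
  by_cases s1 : x + y + z = N
  · rw [if_pos (dvd_of_eq s1.symm), if_pos s1, if_neg (by omega), ← s1]
    push_cast
    ring
  by_cases s2 : x + y + z = 2 * N
  · rw [if_pos (Dvd.intro_left 2 s2.symm), if_neg s1, if_pos s2, ← Nat.cast_add, ← Nat.cast_add, s2]
    push_cast
    ring
  rw [if_neg s1, if_neg s2, if_neg, mul_zero, mul_zero, add_zero]
  rintro ⟨k, hk⟩
  have hk3 : k < 3 := by
    by_contra h3
    have := Nat.mul_le_mul_left N (not_lt.1 h3)
    omega
  interval_cases k <;> omega

variable {p : ℕ} [Fact p.Prime]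

theorem teichOn_zero (a : ℕ) : teichOn p a 0 = 0 := by simp [teichOn]

theorem teichOn_eq_neg (hp : p ≠ 2) {a N x y : ℕ} (haN : a ∣ N) (hpN : p ∣ N) (h : N ∣ x + y) :
    teichOn p a y = -teichOn p a x := by
  have h1 : a ∣ x ↔ a ∣ y :=
    ⟨fun hx => (Nat.dvd_add_right hx).1 (haN.trans h),
      fun hy => (Nat.dvd_add_left hy).1 (haN.trans h)⟩
  have h2 : (y : ZMod p) = -x := by
    rw [eq_neg_iff_add_eq_zero, add_comm, ← Nat.cast_add, ZMod.natCast_eq_zero_iff]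
    exact hpN.trans h
  rw [teichOn, teichOn, h2, teichInv_neg hp]
  simp only [h1]
  split_ifs <;> simp

theorem sum_teichInv_mul (x : ZMod p) (hx : x ≠ 0) :
    ∑ s, teichInv p s * teichInv p (x + s) = teichInv p x ^ 2 * teichJacobi p := by
  rw [teichJacobi, mul_sum]
  refine (Fintype.sum_equiv (Equiv.mulLeft₀ x hx) _ _ fun s => ?_).symm
  change _ = teichInv p (x * s) * teichInv p (x + x * s)
  rw [show x + x * s = x * (1 + s) by ring, map_mul, map_mul]
  ring

theorem sum_teichInv_cube (hp : p ≠ 2) : ∑ s, teichInv p s ^ 3 = 0 := by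
  have h : ∑ s, teichInv p s ^ 3 = -∑ s, teichInv p s ^ 3 := by
    rw [← sum_neg_distrib]
    refine Fintype.sum_equiv (Equiv.neg _) _ _ fun s => ?_
    rw [Equiv.neg_apply, teichInv_neg hp]
    ring
  exact self_eq_neg.1 h

/-- Since ∑ τ³ = 0 by oddness, shifting a block by pα does not change its weighted sum. -/
theorem sum_range_mul_teichInv_cube (hp : p ≠ 2) (k : ℕ) :
    ∑ s ∈ range (k * p), (s : ℤ_[p]) * teichInv p s ^ 3 = k * weightedCubeSum p := by
  have h0 : ∑ x ∈ range p, teichInv p x ^ 3 = 0 := by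
    rw [sum_range_natCast_zmod p (fun s => teichInv p s ^ 3), sum_teichInv_cube hp]
  rw [sum_range_mul, sum_comm]
  have : ∀ α, ∑ x ∈ range p, ((x + p * α : ℕ) : ℤ_[p]) * teichInv p (x + p * α : ℕ) ^ 3
      = weightedCubeSum p := by
    intro α
    rw [weightedCubeSum, ← add_zero (∑ x ∈ range p, (x : ℤ_[p]) * teichInv p x ^ 3),
      ← mul_zero ((p : ℤ_[p]) * α), ← h0, mul_sum, ← sum_add_distrib]
    refine sum_congr rfl fun x _ => ?_
    have : ((x + p * α : ℕ) : ZMod p) = x := by simp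
    rw [this]
    push_cast
    ring
  rw [sum_congr rfl fun α _ => this α, sum_const, card_range, nsmul_eq_mul]

variable {L a b c : ℕ}

/-- Given x and y, z is determined mod pL and τ(z) = −τ(x + y). The sum over y then splits into a
count mod L and a Jacobi-type sum mod p. -/
theorem sum_sum_teichOn (hp : p ≠ 2) (hpL : ¬ p ∣ L) (hb : b ∣ L) (hc : c ∣ L) {x : ℕ}
    (hx : (x : ZMod p) ≠ 0) :
    (∑ y ∈ range (p * L), ∑ z ∈ range (p * L),
      if p * L ∣ x + y + z then teichOn p b y * teichOn p c z else 0)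
      = if b.gcd c ∣ x then -((L / b.lcm c : ℕ) * (teichInv p x ^ 2 * teichJacobi p)) else 0 := by
  have hL : 0 < L := Nat.pos_of_ne_zero fun h => hpL (h ▸ dvd_zero p)
  have hN : 0 < p * L := Nat.mul_pos (Fact.out : p.Prime).pos hL
  have inner : ∀ y, (∑ z ∈ range (p * L),
      if p * L ∣ x + y + z then teichOn p b y * teichOn p c z else 0)
      = -((if b ∣ y ∧ c ∣ x + y then 1 else 0) * (teichInv p y * teichInv p (x + y))) := by
    intro y
    set N := p * L with hNdef
    set z₀ := (N - (x + y) % N) % N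
    have hz₀ : N ∣ x + y + z₀ := by
      rw [← Nat.modEq_zero_iff_dvd]
      have h1 : x + y + z₀ ≡ (x + y) % N + (N - (x + y) % N) [MOD N] :=
        Nat.ModEq.add (Nat.mod_modEq _ _).symm (Nat.mod_modEq _ _)
      rw [Nat.add_sub_cancel' (Nat.mod_lt _ hN).le] at h1
      exact h1.trans (by simp [Nat.ModEq])
    rw [sum_eq_single z₀]
    · rw [if_pos hz₀, teichOn_eq_neg hp (hc.trans (Dvd.intro_left p rfl)) (Dvd.intro L rfl) hz₀,
        teichOn, teichOn]
      by_cases h1 : b ∣ y <;> by_cases h2 : c ∣ x + y <;> simp [h1, h2]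
    · intro z hz hne
      refine if_neg fun h => hne ?_
      have : z ≡ z₀ [MOD N] := Nat.ModEq.add_left_cancel' (x + y)
        ((Nat.modEq_zero_iff_dvd.2 h).trans (Nat.modEq_zero_iff_dvd.2 hz₀).symm)
      rwa [Nat.ModEq, Nat.mod_eq_of_lt (mem_range.1 hz), Nat.mod_mod] at this
    · intro h
      exact absurd (mem_range.2 (Nat.mod_lt _ hN)) h
  simp only [inner, sum_neg_distrib]
  rw [sum_range_mul_of_coprime hpL (fun y => if b ∣ y ∧ c ∣ x + y then 1 else 0) _
      (fun s : ZMod p => teichInv p s * teichInv p (x + s)), sum_teichInv_mul _ hx,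
    sum_range_ite_dvd_and_dvd (Nat.pos_of_dvd_of_pos hb hL) (Nat.pos_of_dvd_of_pos hc hL) hb hc]
  · split_ifs <;> simp
  · intro v α
    have e1 : b ∣ v + L * α ↔ b ∣ v := Nat.dvd_add_left (hb.mul_right α)
    have e2 : c ∣ x + (v + L * α) ↔ c ∣ x + v := by
      rw [← add_assoc]
      exact Nat.dvd_add_left (hc.mul_right α)
    simp only [e1, e2]

theorem modSum_teichOn (hp : p ≠ 2) (hpL : ¬ p ∣ L) (ha : a ∣ L) (hb : b ∣ L) (hc : c ∣ L) :
    modSum (p * L) (fun x y z => (x : ℤ_[p]) * (teichOn p a x * teichOn p b y * teichOn p c z))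
      = -(L * (teichJacobi p * weightedCubeSum p *
        ((L / b.lcm c : ℕ) * teichInv p (a.lcm (b.gcd c) : ℕ) ^ 3))) := by
  have hL : 0 < L := Nat.pos_of_ne_zero fun h => hpL (h ▸ dvd_zero p)
  set d := a.lcm (b.gcd c) with hd
  have hdL : d ∣ L := Nat.lcm_dvd ha ((Nat.gcd_dvd_left b c).trans hb)
  have h1 : modSum (p * L)
      (fun x y z => (x : ℤ_[p]) * (teichOn p a x * teichOn p b y * teichOn p c z))
      = ∑ x ∈ range (p * L), if d ∣ x then
        (-((L / b.lcm c : ℕ) * teichJacobi p)) * (x * teichInv p x ^ 3) else 0 := by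
    refine sum_congr rfl fun x _ => ?_
    have e : ∀ y z, (if p * L ∣ x + y + z then
        (x : ℤ_[p]) * (teichOn p a x * teichOn p b y * teichOn p c z) else 0)
        = (x * teichOn p a x) * if p * L ∣ x + y + z then teichOn p b y * teichOn p c z else 0 := by
      intro y z
      split_ifs <;> ring
    simp only [e, ← mul_sum]
    by_cases hx : (x : ZMod p) = 0
    · simp [teichOn, hx]
    rw [sum_sum_teichOn hp hpL hb hc hx, teichOn]
    have hdx : d ∣ x ↔ a ∣ x ∧ b.gcd c ∣ x := Nat.lcm_dvd_iff
    by_cases h1 : a ∣ x <;> by_cases h2 : b.gcd c ∣ x <;> simp [hdx, h1, h2]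
    ring
  obtain ⟨k, hk⟩ := hdL
  have hd0 : 0 < d := Nat.pos_of_ne_zero fun h => by simp [h] at hk; omega
  -- With L = kd and x = ds, the factor d from the weight and k from the blocks recombine to L.
  rw [h1, show p * L = (k * p) * d by rw [hk]; ring, sum_range_ite_dvd hd0, ← mul_sum]
  have h2 : ∑ s ∈ range (k * p), ((d * s : ℕ) : ℤ_[p]) * teichInv p (d * s : ℕ) ^ 3
      = d * teichInv p d ^ 3 * (k * weightedCubeSum p) := by
    rw [← sum_range_mul_teichInv_cube hp, mul_sum]
    refine sum_congr rfl fun s _ => ?_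
    push_cast
    rw [map_mul]
    ring
  have h3 : (L : ℤ_[p]) = d * k := by rw [hk]; push_cast; ring
  rw [h2, h3]
  ring

/-- The sum of `τ(u) τ(v) τ(w)` over `u + v + w = p L` with `a ∣ u`, `b ∣ v`, `c ∣ w`,
evaluated exactly. -/
theorem p_mul_boxSum_teichOn (hp : p ≠ 2) (hpL : ¬ p ∣ L) (ha : a ∣ L) (hb : b ∣ L) (hc : c ∣ L) :
    p * boxSum (teichOn p a) (teichOn p b) (teichOn p c) (p * L) (p * L)
      = teichJacobi p * weightedCubeSum p *
        ((L / b.lcm c : ℕ) * teichInv p (a.lcm (b.gcd c) : ℕ) ^ 3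
          + (L / c.lcm a : ℕ) * teichInv p (b.lcm (c.gcd a) : ℕ) ^ 3
          + (L / a.lcm b : ℕ) * teichInv p (c.lcm (a.gcd b) : ℕ) ^ 3) := by
  have hL : (L : ℤ_[p]) ≠ 0 := Nat.cast_ne_zero.2 fun h => hpL (h ▸ dvd_zero p)
  have hodd : ∀ a, a ∣ L → ∀ x, 0 < x → x < p * L →
      (0 : ℤ_[p]) ∣ teichOn p a x + teichOn p a (p * L - x) := by
    intro a ha x _ hx
    rw [teichOn_eq_neg hp (x := x) (y := p * L - x) (ha.trans (Dvd.intro_left p rfl))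
      (Dvd.intro L rfl) (dvd_of_eq (Nat.add_sub_cancel' hx.le).symm)]
    simp
  -- Oddness is exact here, so the reflection lemma applies with d = 0 and the two layers cancel.
  have hT := zero_dvd_iff.1 (dvd_boxSum_add_boxSum_two_mul (teichOn_zero (p := p) a)
    (teichOn_zero b) (teichOn_zero c) (hodd a ha) (hodd b hb) (hodd c hc))
  have hW := modSum_add_mul (p * L) (g := teichOn p b) (h := teichOn p c) (teichOn_zero (p := p) a)
  have split : modSum (p * L) (fun x y z => ((x : ℤ_[p]) + y + z)
        * (teichOn p a x * teichOn p b y * teichOn p c z))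
      = modSum (p * L) (fun x y z => (x : ℤ_[p]) * (teichOn p a x * teichOn p b y * teichOn p c z))
      + modSum (p * L) (fun x y z => (x : ℤ_[p]) * (teichOn p b x * teichOn p c y * teichOn p a z))
      + modSum (p * L)
        (fun x y z => (x : ℤ_[p]) * (teichOn p c x * teichOn p a y * teichOn p b z)) := by
    rw [modSum_swap_right (p * L)
        (fun x y z => (x : ℤ_[p]) * (teichOn p b x * teichOn p c y * teichOn p a z)),
      modSum_swap_left (p * L)
        (fun x z y => (x : ℤ_[p]) * (teichOn p b x * teichOn p c y * teichOn p a z)),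
      modSum_swap_left (p * L)
        (fun x y z => (x : ℤ_[p]) * (teichOn p c x * teichOn p a y * teichOn p b z)),
      modSum_swap_right (p * L)
        (fun y x z => (x : ℤ_[p]) * (teichOn p c x * teichOn p a y * teichOn p b z))]
    simp only [modSum, ← sum_add_distrib]
    refine sum_congr rfl fun x _ => sum_congr rfl fun y _ => sum_congr rfl fun z _ => ?_
    split_ifs <;> ring
  rw [split, modSum_teichOn hp hpL ha hb hc, modSum_teichOn hp hpL hb hc ha,
    modSum_teichOn hp hpL hc ha hb] at hW
  refine mul_left_cancel₀ hL ?_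
  push_cast at hW ⊢
  linear_combination (2 * (p : ℤ_[p]) * L) * hT + hW

/-! ### Bernoulli numbers and the weighted cube sum mod p² -/

variable {p : ℕ} [Fact p.Prime]

theorem bernoulli_mem_subring {k : ℕ} (hk : k + 1 < p) :
    (bernoulli k : ℚ_[p]) ∈ PadicInt.subring p := by
  induction k using Nat.strong_induction_on with
  | _ k ih =>
    have h := sum_bernoulli (k + 1)
    rw [sum_range_succ, Nat.choose_succ_self_right] at h
    have h' : ((k + 1 : ℕ) : ℚ_[p]) * (bernoulli k : ℚ_[p]) = (if k + 1 = 1 then 1 else 0)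
        - ∑ j ∈ range k, ((k + 1).choose j : ℚ_[p]) * (bernoulli j : ℚ_[p]) := by
      have := congrArg (fun q : ℚ => (q : ℚ_[p])) (eq_sub_of_add_eq' h)
      push_cast at this ⊢
      rw [this]
      split_ifs <;> simp
    have hmem : ((k + 1 : ℕ) : ℚ_[p]) * (bernoulli k : ℚ_[p]) ∈ PadicInt.subring p := by
      rw [h']
      refine sub_mem ?_ (sum_mem fun j hj => mul_mem (natCast_mem _ _)
        (ih j (mem_range.1 hj) (by have := mem_range.1 hj; omega)))
      split_ifs
      · exact one_mem _
      · exact zero_mem _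
    have hnorm : ‖((k + 1 : ℕ) : ℚ_[p])‖ = 1 :=
      Padic.norm_natCast_eq_one_iff.2
      (((Fact.out : p.Prime).coprime_iff_not_dvd).2 (Nat.not_dvd_of_pos_of_lt k.succ_pos hk))
    have h1 : ‖((k + 1 : ℕ) : ℚ_[p]) * (bernoulli k : ℚ_[p])‖ ≤ 1 := hmem
    rw [norm_mul, hnorm, one_mul] at h1
    exact h1

/-- In Faulhaber's formula multiplied by n + 1, the term i = n is (n + 1)pB_n and all earlier ones
are p-integral multiples of p². The factor n + 1 = p − 2 is a unit. -/
theorem exists_bernoulli_sum_pow {n : ℕ} (hp : p = n + 3) :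
    ∃ B : ℤ_[p], (B : ℚ_[p]) = (bernoulli n : ℚ) ∧
      (p : ℤ_[p]) ^ 2 ∣ ∑ x ∈ range p, (x : ℤ_[p]) ^ n - p * B := by
  have hB : ∀ k, k ≤ n → ∃ B : ℤ_[p], (B : ℚ_[p]) = (bernoulli k : ℚ) := fun k hk =>
    ⟨⟨_, bernoulli_mem_subring (p := p) (k := k) (by omega)⟩, rfl⟩
  choose! B hB using hB
  refine ⟨B n, hB n le_rfl, ?_⟩
  have hu : IsUnit ((n + 1 : ℕ) : ℤ_[p]) := by
    rw [PadicInt.isUnit_iff, PadicInt.norm_natCast_eq_one_iff]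
    exact ((Fact.out : p.Prime).coprime_iff_not_dvd).2
      (Nat.not_dvd_of_pos_of_lt n.succ_pos (by omega))
  obtain ⟨u, hu⟩ := hu
  have h := sum_range_pow p n
  rw [sum_range_succ] at h
  have key : ((n + 1 : ℕ) : ℤ_[p]) * (∑ x ∈ range p, (x : ℤ_[p]) ^ n - p * B n)
      = ∑ i ∈ range n, B i * ((n + 1).choose i) * (p : ℤ_[p]) ^ (n + 1 - i) := by
    refine PadicInt.ext (?_ : ((_ : ℤ_[p]) : ℚ_[p]) = ((_ : ℤ_[p]) : ℚ_[p]))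
    have h' := congrArg (fun q : ℚ => (q : ℚ_[p])) h
    have hn : (n : ℚ_[p]) + 1 ≠ 0 := by exact_mod_cast Nat.succ_ne_zero n
    rw [Nat.choose_succ_self_right, Nat.add_sub_cancel_left, pow_one] at h'
    rw [PadicInt.coe_mul, PadicInt.coe_sub, PadicInt.coe_sum, PadicInt.coe_sum]
    push_cast at h' ⊢
    rw [h', mul_sub, mul_add, mul_sum, hB n le_rfl]
    have : ∀ i ∈ range n, (n + 1 : ℚ_[p]) * ((bernoulli i : ℚ) * ((n + 1).choose i)
        * (p : ℚ_[p]) ^ (n + 1 - i) / (n + 1))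
        = B i * ((n + 1).choose i) * (p : ℚ_[p]) ^ (n + 1 - i) := by
      intro i hi
      rw [hB i (mem_range.1 hi).le]
      field_simp
    rw [sum_congr rfl this]
    field_simp
    ring
  rw [← hu] at key
  have hd : (p : ℤ_[p]) ^ 2 ∣ u * (∑ x ∈ range p, (x : ℤ_[p]) ^ n - p * B n) := by
    rw [key]
    refine dvd_sum fun i hi => Dvd.dvd.mul_left (pow_dvd_pow _ ?_) _
    have := mem_range.1 hi
    omega
  exact (Units.dvd_mul_left).1 hd

/-- The carry in the doubling of a residue. -/
def doublingCarry (x : ZMod p) : ℕ := 2 * x.val / p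

theorem val_two_mul_add (x : ZMod p) :
    (((2 * x : ZMod p).val : ℕ) : ℤ_[p]) = 2 * (x.val : ℤ_[p]) - p * doublingCarry x := by
  have h : (2 * x : ZMod p).val = 2 * x.val % p := by
    rw [← ZMod.val_natCast]
    simp
  rw [h, eq_sub_iff_add_eq, doublingCarry]
  exact_mod_cast Nat.mod_add_div (2 * x.val) p

/-- Substitute x ↦ 2x in E = ∑ xτ(x)³ and P = ∑ x^(k+1). With c = τ(2)³ and the carries collected in
Q₁, Q₂, this gives (1 − 2c)E = −pcQ₁ and (1 − 2^(k+1))P ≡ −(k+1)2^k pQ₂ mod p². Modulo p, c ≡ 2^k,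
Q₁ ≡ Q₂ and k + 1 ≡ −3; also p ∣ P. So (1 − 2c)(3E + P) ≡ 0 mod p², and 1 − 2c ≡ 3/4 is a unit. -/
theorem dvd_three_mul_weightedCubeSum_add {k : ℕ} (hp : p = k + 4) (hk : 0 < k) :
    (p : ℤ_[p]) ^ 2 ∣ 3 * weightedCubeSum p + ∑ x ∈ range p, (x : ℤ_[p]) ^ (k + 1) := by
  have h2 : (2 : ZMod p) ≠ 0 := by
    intro h
    have h' : ((2 : ℕ) : ZMod p) = 0 := by exact_mod_cast h
    have := Nat.le_of_dvd two_pos ((ZMod.natCast_eq_zero_iff 2 p).1 h')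
    omega
  have h3 : (3 : ZMod p) ≠ 0 := by
    intro h
    have h' : ((3 : ℕ) : ZMod p) = 0 := by exact_mod_cast h
    have := Nat.le_of_dvd three_pos ((ZMod.natCast_eq_zero_iff 3 p).1 h')
    omega
  have hinv : ∀ x : ZMod p, x ≠ 0 → x⁻¹ ^ 3 = x ^ k := by
    intro x hx
    have h1 := ZMod.pow_card_sub_one_eq_one hx
    rw [show p - 1 = k + 3 by omega, pow_add] at h1
    rw [inv_pow]
    exact inv_eq_of_mul_eq_one_left h1
  set E := weightedCubeSum p
  set P := ∑ x ∈ range p, (x : ℤ_[p]) ^ (k + 1)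
  set c := teichInv p 2 ^ 3
  set Q₁ := ∑ x : ZMod p, (doublingCarry x : ℤ_[p]) * teichInv p x ^ 3
  set Q₂ := ∑ x : ZMod p, (doublingCarry x : ℤ_[p]) * (x.val : ℤ_[p]) ^ k
  have hE0 : E = ∑ x : ZMod p, (x.val : ℤ_[p]) * teichInv p x ^ 3 := by
    rw [← sum_range_natCast_zmod p (fun x => (x.val : ℤ_[p]) * teichInv p x ^ 3)]
    exact sum_congr rfl fun x hx => by rw [ZMod.val_cast_of_lt (mem_range.1 hx)]
  have hP0 : P = ∑ x : ZMod p, (x.val : ℤ_[p]) ^ (k + 1) := by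
    rw [← sum_range_natCast_zmod p (fun x => (x.val : ℤ_[p]) ^ (k + 1))]
    exact sum_congr rfl fun x hx => by rw [ZMod.val_cast_of_lt (mem_range.1 hx)]
  have double : ∀ φ : ZMod p → ℤ_[p], ∑ x, φ x = ∑ x, φ (2 * x) := fun φ =>
    (Fintype.sum_equiv (Equiv.mulLeft₀ (2 : ZMod p) h2) _ _ fun x => rfl).symm
  have hE : E = 2 * c * E - p * c * Q₁ := by
    conv_lhs => rw [hE0, double]
    rw [hE0, mul_sum, mul_sum, ← sum_sub_distrib]
    refine sum_congr rfl fun x _ => ?_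
    rw [val_two_mul_add, map_mul]
    ring
  have hP : (p : ℤ_[p]) ^ 2 ∣ P - (2 ^ (k + 1) * P - (k + 1) * 2 ^ k * p * Q₂) := by
    nth_rewrite 1 [hP0]
    rw [double, hP0, mul_sum, mul_sum, ← sum_sub_distrib, ← sum_sub_distrib]
    refine dvd_sum fun x _ => ?_
    rw [val_two_mul_add]
    obtain ⟨t, ht⟩ := (Polynomial.powAddExpansion (2 * (x.val : ℤ_[p]))
      (-(p * doublingCarry x)) (k + 1))
    rw [sub_eq_add_neg (2 * (x.val : ℤ_[p])), ht]
    refine ⟨t * doublingCarry x ^ 2, ?_⟩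
    push_cast
    ring
  have hQ : (p : ℤ_[p]) ∣ Q₁ - Q₂ := by
    rw [← sum_sub_distrib]
    refine dvd_sum fun x _ => ?_
    rw [← mul_sub]
    by_cases hx : x = 0
    · simp [hx, doublingCarry]
    refine Dvd.dvd.mul_left ?_ _
    rw [← toZMod_eq_zero_iff, map_sub, map_pow, map_pow, toZMod_teichInv, hinv x hx, map_natCast,
      ZMod.natCast_zmod_val, sub_self]
  have hc : (p : ℤ_[p]) ∣ c - 2 ^ k := by
    rw [← toZMod_eq_zero_iff, map_sub, map_pow, map_pow, toZMod_teichInv, hinv 2 h2, map_ofNat,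
      sub_self]
  obtain ⟨B, -, hPB⟩ := exists_bernoulli_sum_pow (p := p) (n := k + 1) (by omega)
  have hPp : (p : ℤ_[p]) ∣ P :=
    (dvd_sub_left (Dvd.intro _ rfl)).1 ((Dvd.intro_left _ (sq (p : ℤ_[p])).symm).trans hPB)
  have hunit : IsUnit (1 - 2 * c) := by
    rw [← not_not (a := IsUnit _), ← mem_nonunits_iff, ← IsLocalRing.mem_maximalIdeal,
      ← PadicInt.ker_toZMod, RingHom.mem_ker, map_sub, map_mul, map_pow, toZMod_teichInv, map_one,
      map_ofNat]
    intro h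
    apply h3
    field_simp at h
    linear_combination h
  obtain ⟨u, hu⟩ := hunit
  refine (Units.dvd_mul_left (u := u)).1 ?_
  rw [hu]
  obtain ⟨s, hs⟩ := hP
  obtain ⟨q, hq⟩ := hQ
  obtain ⟨e, he⟩ := hc
  obtain ⟨w, hw⟩ := hPp
  have hpk : (p : ℤ_[p]) = k + 4 := by exact_mod_cast congrArg (Nat.cast (R := ℤ_[p])) hp
  refine ⟨s - 2 * e * w - 3 * e * Q₁ - 3 * 2 ^ k * q - 2 ^ k * Q₂, ?_⟩
  have hE' : (1 - 2 * c) * E = - p * c * Q₁ := by linear_combination hE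
  have hP' : (1 - 2 ^ (k + 1)) * P = p ^ 2 * s - (p - 3) * 2 ^ k * p * Q₂ := by
    linear_combination hs + 2 ^ k * p * Q₂ * hpk
  linear_combination 3 * hE' + hP' - 2 * P * he - 2 * (p : ℤ_[p]) * e * hw
    - 3 * (p : ℤ_[p]) * Q₁ * he - 3 * (p : ℤ_[p]) * 2 ^ k * hq
-- Sums of p-adic reciprocals under dilation
variable {p : ℕ} [Fact p.Prime]

theorem isUnit_natCast_iff {n : ℕ} : IsUnit (n : ℤ_[p]) ↔ ¬ p ∣ n := by
  rw [PadicInt.isUnit_iff, PadicInt.norm_natCast_eq_one_iff,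
    (Fact.out : p.Prime).coprime_iff_not_dvd]

variable (p) in
/-- The `p`-adic reciprocal of `n`, extended by `0` to the multiples of `p`. -/
noncomputable def recip (n : ℕ) : ℤ_[p] := Ring.inverse (n : ℤ_[p])

theorem recip_of_dvd {n : ℕ} (h : p ∣ n) : recip p n = 0 :=
  Ring.inverse_non_unit _ fun hu => isUnit_natCast_iff.1 hu h

theorem mul_recip {n : ℕ} (h : ¬ p ∣ n) : (n : ℤ_[p]) * recip p n = 1 :=
  Ring.mul_inverse_cancel _ (isUnit_natCast_iff.2 h)

theorem coe_recip {n : ℕ} (h : ¬ p ∣ n) : (recip p n : ℚ_[p]) = (n : ℚ_[p])⁻¹ := by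
  refine eq_inv_of_mul_eq_one_right ?_
  exact_mod_cast congrArg (fun x : ℤ_[p] => (x : ℚ_[p])) (mul_recip h)

theorem toZMod_recip (n : ℕ) : PadicInt.toZMod (recip p n) = (n : ZMod p)⁻¹ := by
  by_cases h : p ∣ n
  · rw [recip_of_dvd h, map_zero, (ZMod.natCast_eq_zero_iff n p).2 h, inv_zero]
  · refine eq_inv_of_mul_eq_one_right ?_
    rw [← map_natCast (PadicInt.toZMod (p := p)), ← map_mul, mul_recip h, map_one]

theorem dvd_recip_sub_teichInv (n : ℕ) : (p : ℤ_[p]) ∣ recip p n - teichInv p n := by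
  rw [← toZMod_eq_zero_iff, map_sub, toZMod_recip, toZMod_teichInv, sub_self]

variable (p) in
/-- The `p`-adic reciprocal restricted to multiples of `a`. -/
noncomputable def recipOn (a u : ℕ) : ℤ_[p] := if a ∣ u then recip p u else 0

theorem recipOn_zero (a : ℕ) : recipOn p a 0 = 0 := by
  simp [recipOn, recip_of_dvd]

theorem dvd_recipOn_sub_teichOn (a n : ℕ) : (p : ℤ_[p]) ∣ recipOn p a n - teichOn p a n := by
  rw [recipOn, teichOn]
  split_ifs
  · exact dvd_recip_sub_teichInv n
  · simp

theorem dvd_recipOn_add {a N : ℕ} (haN : a ∣ N) (hpN : p ∣ N) {x : ℕ} (hx : x < N) :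
    (N : ℤ_[p]) ∣ recipOn p a x + recipOn p a (N - x) := by
  have h1 : a ∣ N - x ↔ a ∣ x := Nat.dvd_sub_iff_right hx.le haN
  simp only [recipOn, h1]
  split_ifs
  · by_cases h : p ∣ x
    · rw [recip_of_dvd h, recip_of_dvd ((Nat.dvd_sub_iff_right hx.le hpN).2 h), add_zero]
      exact dvd_zero _
    · have e1 := mul_recip h
      have e2 := mul_recip fun h' => h ((Nat.dvd_sub_iff_right hx.le hpN).1 h')
      rw [Nat.cast_sub hx.le] at e2
      exact ⟨recip p x * recip p (N - x), by
        linear_combination -recip p (N - x) * e1 - recip p x * e2⟩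
  · simp

theorem dvd_recipOn_add_mul_sub {a N : ℕ} (haN : a ∣ N) (hpN : p ∣ N) (x α : ℕ) :
    (N : ℤ_[p]) * N ∣ recipOn p a (x + N * α)
      - recipOn p a x * (1 + -(N : ℤ_[p]) * recip p x * α) := by
  have h1 : a ∣ x + N * α ↔ a ∣ x := Nat.dvd_add_left (haN.mul_right α)
  have h2 : p ∣ x + N * α ↔ p ∣ x := Nat.dvd_add_left (hpN.mul_right α)
  simp only [recipOn, h1]
  split_ifs
  · by_cases h : p ∣ x
    · simp [recip_of_dvd h, recip_of_dvd (h2.2 h)]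
    · have e1 := mul_recip h
      have e2 := mul_recip fun h' => h (h2.1 h')
      push_cast at e2
      set i := recip p x
      set j := recip p (x + N * α)
      -- This is the exact remainder: j = i − Nαi² + N²α²i²j.
      refine ⟨α ^ 2 * i ^ 2 * j, ?_⟩
      linear_combination (-j + j * N * α * i) * e1 + (i - N * α * i ^ 2) * e2
  · simp

variable (p) in
/-- The sum of `1 / (u v w)` over `u + v + w = s`, `u, v, w < N`, `p ∤ u v w`, `a ∣ u`, `b ∣ v`,
`c ∣ w`. -/
noncomputable def recipSum (a b c N s : ℕ) : ℤ_[p] :=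
  boxSum (recipOn p a) (recipOn p b) (recipOn p c) N s

variable {a b c N : ℕ}

theorem dvd_recipSum_add (ha : a ∣ N) (hb : b ∣ N) (hc : c ∣ N) (hpN : p ∣ N) :
    (N : ℤ_[p]) ∣ recipSum p a b c N N + recipSum p a b c N (2 * N) :=
  dvd_boxSum_add_boxSum_two_mul (recipOn_zero a) (recipOn_zero b) (recipOn_zero c)
    (fun _ _ hx => dvd_recipOn_add ha hpN hx) (fun _ _ hx => dvd_recipOn_add hb hpN hx)
    (fun _ _ hx => dvd_recipOn_add hc hpN hx)

/-- The layer 2N is minus the layer N modulo N, so the coefficient becomes C(m+1, 2) − C(m, 2) = m.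
-/
theorem dvd_recipSum_mul_sub (ha : a ∣ N) (hb : b ∣ N) (hc : c ∣ N) (hpN : p ∣ N) {m : ℕ}
    (hm : 0 < m) {D : ℤ_[p]} (hD : D ∣ N * N) (hD' : D ∣ m.choose 2 * N)
    (hlin : ∀ x y z, p ∣ x + y + z → ¬ p ∣ x → ¬ p ∣ y → ¬ p ∣ z →
      D ∣ N * ((m + 1).choose 3 * (recip p x + recip p y + recip p z)) ∧
      D ∣ N * (m.choose 3 * (recip p x + recip p y + recip p z))) :
    D ∣ recipSum p a b c (m * N) (m * N) - m * recipSum p a b c N N := by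
  have hunit : ∀ {x y z : ℕ}, recipOn p a x * recipOn p b y * recipOn p c z ≠ 0 →
      ¬ p ∣ x ∧ ¬ p ∣ y ∧ ¬ p ∣ z := by
    intro x y z h
    refine ⟨fun hx => h ?_, fun hy => h ?_, fun hz => h ?_⟩
    · simp [recipOn, recip_of_dvd hx]
    · simp [recipOn, recip_of_dvd hy]
    · simp [recipOn, recip_of_dvd hz]
  have key := dvd_boxSum_mul_sub (ψ := recip p) (N := N) (e := -(N : ℤ_[p])) (D := D) hm
    (recipOn_zero a) (recipOn_zero b) (recipOn_zero c) (by rwa [neg_mul_neg])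
    (fun x α => hD.trans (dvd_recipOn_add_mul_sub ha hpN x α))
    (fun x α => hD.trans (dvd_recipOn_add_mul_sub hb hpN x α))
    (fun x α => hD.trans (dvd_recipOn_add_mul_sub hc hpN x α))
    (fun x y z hs h0 => by
      obtain ⟨hx, hy, hz⟩ := hunit h0
      refine (((hlin x y z (by rw [hs]; exact hpN) hx hy hz).1).mul_left (-1)).trans
        (dvd_of_eq (by ring)))
    (fun x y z hs h0 => by
      obtain ⟨hx, hy, hz⟩ := hunit h0
      refine (((hlin x y z (by rw [hs]; exact hpN.mul_left 2) hx hy hz).2).mul_left (-1)).trans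
        (dvd_of_eq (by ring)))
  have h2 : D ∣ m.choose 2 * (recipSum p a b c N N + recipSum p a b c N (2 * N)) :=
    hD'.trans (mul_dvd_mul_left _ (dvd_recipSum_add ha hb hc hpN))
  refine (dvd_add key h2).trans (dvd_of_eq ?_)
  rw [Nat.choose_succ_succ' m 1, Nat.choose_one_right, recipSum, recipSum, recipSum]
  push_cast
  ring

theorem dvd_recipSum_nat_mul_sub (ha : a ∣ N) (hb : b ∣ N) (hc : c ∣ N) (hpN : p ∣ N) {m : ℕ}
    (hm : 0 < m) : (N : ℤ_[p]) ∣ recipSum p a b c (m * N) (m * N) - m * recipSum p a b c N N :=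
  dvd_recipSum_mul_sub ha hb hc hpN hm (Dvd.intro _ rfl) (Dvd.intro_left _ rfl)
    fun _ _ _ _ _ _ _ => ⟨Dvd.intro _ rfl, Dvd.intro _ rfl⟩

theorem dvd_recip_add_recip_add_recip (hp : p = 3) {x y z : ℕ} (h : p ∣ x + y + z)
    (hx : ¬ p ∣ x) (hy : ¬ p ∣ y) (hz : ¬ p ∣ z) :
    (p : ℤ_[p]) ∣ recip p x + recip p y + recip p z := by
  subst hp
  rw [← toZMod_eq_zero_iff, map_add, map_add, toZMod_recip, toZMod_recip, toZMod_recip]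
  rw [← ZMod.natCast_eq_zero_iff] at h hx hy hz
  push_cast at h
  have hinv : ∀ x : ZMod 3, x ≠ 0 → x⁻¹ = x := by
    intro x hx
    exact inv_eq_of_mul_eq_one_left (by simpa [sq] using ZMod.pow_card_sub_one_eq_one hx)
  rw [hinv _ hx, hinv _ hy, hinv _ hz, h]

/-- For p > 3 the binomials in the linear terms are divisible by p. For p = 3 they are not, but 1/x
≡ x mod 3, so 1/x + 1/y + 1/z ≡ x + y + z ≡ 0. -/
theorem dvd_recipSum_prime_mul_sub (hp : p ≠ 2) (ha : a ∣ N) (hb : b ∣ N) (hc : c ∣ N)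
    (hpN : p ∣ N) :
    (p : ℤ_[p]) * N ∣ recipSum p a b c (p * N) (p * N) - p * recipSum p a b c N N := by
  have hprime : p.Prime := Fact.out
  have h3 : 3 ≤ p := by
    have := hprime.two_le
    omega
  have hcast : ∀ {k : ℕ}, p ∣ k → (p : ℤ_[p]) ∣ k := fun h => by exact_mod_cast Nat.cast_dvd_cast h
  refine dvd_recipSum_mul_sub ha hb hc hpN hprime.pos (mul_dvd_mul_right (hcast hpN) _)
    (mul_dvd_mul_right (hcast (hprime.dvd_choose_self two_ne_zero (by omega))) _) ?_
  intro x y z hs hx hy hz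
  rw [mul_comm (p : ℤ_[p])]
  by_cases hp3 : p = 3
  · have := dvd_recip_add_recip_add_recip hp3 hs hx hy hz
    exact ⟨mul_dvd_mul_left _ (this.mul_left _), mul_dvd_mul_left _ (this.mul_left _)⟩
  · have d2 : p ∣ p.choose 2 := hprime.dvd_choose_self two_ne_zero (by omega)
    have d3 : p ∣ p.choose 3 := hprime.dvd_choose_self three_ne_zero (by omega)
    have d4 : p ∣ (p + 1).choose 3 := by
      rw [Nat.choose_succ_succ' p 2]
      exact dvd_add d2 d3
    exact ⟨mul_dvd_mul_left _ ((hcast d4).mul_right _), mul_dvd_mul_left _ ((hcast d3).mul_right _)⟩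

theorem dvd_recipSum_prime_pow_mul_sub (hp : p ≠ 2) (ha : a ∣ N) (hb : b ∣ N) (hc : c ∣ N)
    (hpN : p ∣ N) (s : ℕ) :
    (p : ℤ_[p]) ^ (s + 1) ∣ recipSum p a b c (p ^ s * N) (p ^ s * N)
      - p ^ s * recipSum p a b c N N := by
  have hpN' : (p : ℤ_[p]) ∣ N := by exact_mod_cast Nat.cast_dvd_cast hpN
  induction s with
  | zero => simp
  | succ s ih =>
    have h := dvd_recipSum_prime_mul_sub hp (ha.mul_left (p ^ s)) (hb.mul_left (p ^ s))
      (hc.mul_left (p ^ s)) (hpN.mul_left (p ^ s))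
    have h1 : (p : ℤ_[p]) ^ (s + 1 + 1) ∣ p * ((p ^ s * N : ℕ) : ℤ_[p]) := by
      rw [pow_succ', pow_succ]
      push_cast
      exact mul_dvd_mul_left _ (mul_dvd_mul_left _ hpN')
    have h2 := mul_dvd_mul_left (p : ℤ_[p]) ih
    rw [← pow_succ'] at h2
    have h3 := dvd_add (h1.trans h) h2
    rw [← mul_assoc p, ← pow_succ'] at h3
    exact h3.trans (dvd_of_eq (by ring))

theorem dvd_recipSum_sub_boxSum_teichOn (a b c N s : ℕ) :
    (p : ℤ_[p]) ∣ recipSum p a b c N s - boxSum (teichOn p a) (teichOn p b) (teichOn p c) N s := by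
  simp only [recipSum, boxSum, ← sum_sub_distrib]
  refine dvd_sum fun x _ => dvd_sum fun y _ => dvd_sum fun z _ => ?_
  split_ifs
  · obtain ⟨i, hi⟩ := dvd_recipOn_sub_teichOn (p := p) a x
    obtain ⟨j, hj⟩ := dvd_recipOn_sub_teichOn (p := p) b y
    obtain ⟨k, hk⟩ := dvd_recipOn_sub_teichOn (p := p) c z
    exact ⟨i * recipOn p b y * recipOn p c z + teichOn p a x * j * recipOn p c z
      + teichOn p a x * teichOn p b y * k, by
        linear_combination (recipOn p b y * recipOn p c z) * hi
          + (teichOn p a x * recipOn p c z) * hj + teichOn p a x * teichOn p b y * hk⟩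
  · simp

theorem dvd_teichJacobi_sub_two : (p : ℤ_[p]) ∣ teichJacobi p - 2 := by
  rw [← toZMod_eq_zero_iff, map_sub, map_ofNat, teichJacobi, map_sum]
  -- Partial fractions; the two indicators correct the poles, where 0⁻¹ = 0, and they alone survive
  -- summation.
  have h1 : ∀ s : ZMod p, PadicInt.toZMod (teichInv p s * teichInv p (1 + s))
      = s⁻¹ - (1 + s)⁻¹ + (if s = 0 then 1 else 0) + (if s = -1 then 1 else 0) := by
    intro s
    rw [map_mul, toZMod_teichInv, toZMod_teichInv]
    by_cases h0 : s = 0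
    · simp [h0]
    by_cases h1 : s = -1
    · simp [h1, inv_neg]
    have h2 : 1 + s ≠ 0 := fun h => h1 (eq_neg_of_add_eq_zero_right h)
    rw [if_neg h0, if_neg h1]
    field_simp
    ring
  have h2 : ∑ s : ZMod p, (1 + s)⁻¹ = ∑ s : ZMod p, s⁻¹ :=
    Fintype.sum_equiv (Equiv.addLeft 1) _ _ fun s => rfl
  simp only [h1, sum_add_distrib, sum_sub_distrib, h2]
  simp
  norm_num

/-! ### The base sum at total pL -/

variable {p : ℕ} [Fact p.Prime] {L a b c : ℕ}

variable (p) in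
/-- The `p`-adic expression `∑ (L / lcm (b, c)) / lcm (a, gcd (b, c))³`, cyclically in `a, b, c`. -/
noncomputable def lcmSum (L a b c : ℕ) : ℤ_[p] :=
  (L / b.lcm c : ℕ) * recip p (a.lcm (b.gcd c)) ^ 3
    + (L / c.lcm a : ℕ) * recip p (b.lcm (c.gcd a)) ^ 3
    + (L / a.lcm b : ℕ) * recip p (c.lcm (a.gcd b)) ^ 3

variable (p) in
/-- The Teichmüller analogue of `lcmSum`. -/
noncomputable def teichLcmSum (L a b c : ℕ) : ℤ_[p] :=
  (L / b.lcm c : ℕ) * teichInv p (a.lcm (b.gcd c) : ℕ) ^ 3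
    + (L / c.lcm a : ℕ) * teichInv p (b.lcm (c.gcd a) : ℕ) ^ 3
    + (L / a.lcm b : ℕ) * teichInv p (c.lcm (a.gcd b) : ℕ) ^ 3

theorem dvd_teichLcmSum_sub_lcmSum : (p : ℤ_[p]) ∣ teichLcmSum p L a b c - lcmSum p L a b c := by
  simp only [← toZMod_eq_zero_iff, teichLcmSum, lcmSum, map_sub, map_add, map_mul, map_pow,
    toZMod_recip, toZMod_teichInv, sub_self]

theorem prime_cast_ne_zero : (p : ℤ_[p]) ≠ 0 :=
  Nat.cast_ne_zero.2 (Fact.out : p.Prime).ne_zero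

theorem lcm_mul_gcd_gcd (a b c : ℕ) :
    a.lcm (b.gcd c) * a.gcd (b.gcd c) = a * b.gcd c := by
  rw [mul_comm, Nat.gcd_mul_lcm]

theorem mul_mul_div_lcm (hb : b ∣ L) (hc : c ∣ L) :
    a * b * c * (L / b.lcm c) = L * (a.lcm (b.gcd c) * a.gcd (b.gcd c)) := by
  rw [lcm_mul_gcd_gcd]
  calc a * b * c * (L / b.lcm c) = a * (b * c) * (L / b.lcm c) := by ring
    _ = a * b.gcd c * (b.lcm c * (L / b.lcm c)) := by rw [← Nat.gcd_mul_lcm b c]; ring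
    _ = L * (a * b.gcd c) := by rw [Nat.mul_div_cancel' (Nat.lcm_dvd hb hc)]; ring

/-- For `p > 3`, the sum over `u + v + w = p L` modulo `p`. -/
theorem dvd_three_mul_recipSum_add {B : ℤ_[p]} {k : ℕ} (hp : p = k + 4) (hk : 0 < k)
    (hB : (B : ℚ_[p]) = (bernoulli (p - 3) : ℚ))
    (hpL : ¬ p ∣ L) (ha : a ∣ L) (hb : b ∣ L) (hc : c ∣ L) :
    (p : ℤ_[p]) ∣ 3 * recipSum p a b c (p * L) (p * L) + 2 * B * lcmSum p L a b c := by
  have hT := p_mul_boxSum_teichOn (p := p) (by omega) hpL ha hb hc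
  rw [← teichLcmSum] at hT
  obtain ⟨B', hB', hPB⟩ := exists_bernoulli_sum_pow (p := p) (n := k + 1) (by omega)
  have hBB : B' = B := by
    refine PadicInt.ext ?_
    rw [hB, hB', show p - 3 = k + 1 by omega]
  rw [hBB] at hPB
  obtain ⟨w, hw⟩ := dvd_sub (dvd_three_mul_weightedCubeSum_add hp hk) hPB
  obtain ⟨j, hj⟩ := dvd_teichJacobi_sub_two (p := p)
  obtain ⟨x, hx⟩ := dvd_teichLcmSum_sub_lcmSum (p := p) (L := L) (a := a) (b := b) (c := c)
  obtain ⟨t, ht⟩ := dvd_recipSum_sub_boxSum_teichOn (p := p) a b c (p * L) (p * L)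
  have h3 : 3 * boxSum (teichOn p a) (teichOn p b) (teichOn p c) (p * L) (p * L)
      = teichJacobi p * (p * w - B) * teichLcmSum p L a b c := by
    -- Cancelling p loses one power, which is why the cube sum is needed mod p².
    refine mul_left_cancel₀ (prime_cast_ne_zero (p := p)) ?_
    linear_combination 3 * hT + teichJacobi p * teichLcmSum p L a b c * hw
  exact ⟨3 * t + teichJacobi p * w * teichLcmSum p L a b c - j * B * teichLcmSum p L a b c
    - 2 * B * x, by
      linear_combination 3 * ht + h3 - B * teichLcmSum p L a b c * hj - 2 * B * hx⟩

/-- Here τ(d)² = 1. Writing dτ(d) = 1 + 3e, the expression dτ³ + 2d/d³ becomes (1 + 3e) + 2(1 +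
3e)⁻² ≡ 3 mod 9. -/
theorem nine_dvd_mul_teichInv_add (hp : p = 3) {d : ℕ} (hd : ¬ p ∣ d) :
    (9 : ℤ_[p]) ∣ d * (teichInv p d ^ 3 + 2 * recip p d ^ 3) - 3 := by
  have hd0 : (d : ZMod p) ≠ 0 := fun h => hd ((ZMod.natCast_eq_zero_iff d p).1 h)
  have hsq : teichInv p d ^ 2 = 1 := by
    rw [← map_pow]
    have := ZMod.pow_card_sub_one_eq_one hd0
    rw [show p - 1 = 2 by omega] at this
    rw [this, map_one]
  have hmul := mul_recip hd
  have h3 : (p : ℤ_[p]) = 3 := by exact_mod_cast congrArg (Nat.cast (R := ℤ_[p])) hp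
  obtain ⟨e, he⟩ : (3 : ℤ_[p]) ∣ d * teichInv p d - 1 := by
    rw [← h3, ← toZMod_eq_zero_iff, map_sub, map_mul, map_natCast, toZMod_teichInv,
      mul_inv_cancel₀ hd0, map_one, sub_self]
  set τ := teichInv p d
  set i := recip p d
  have hyi : (1 + 3 * e) ^ 2 * i ^ 2 = 1 := by
    rw [show 1 + 3 * e = d * τ by linear_combination -he]
    linear_combination (d * i * τ ^ 2 + τ ^ 2) * hmul + hsq
  exact ⟨i ^ 2 * e * (3 * e ^ 2 - 1), by
    linear_combination d * τ * hsq + he + 2 * i ^ 2 * hmul - (3 * e - 2) * hyi⟩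

/-- Multiplying by abc turns each L / lcm(b, c) into Lgd with d = lcm(a, gcd(b, c)) and g = gcd(a,
b, c). The three terms are then each 3Lg mod 9, and they add up to 0. -/
theorem nine_dvd_mul_recipSum_add (hp : p = 3) (hpL : ¬ p ∣ L)
    (ha : a ∣ L) (hb : b ∣ L) (hc : c ∣ L) :
    (9 : ℤ_[p]) ∣ (a * b * c : ℕ) *
      (3 * recipSum p a b c (p * L) (p * L) + 2 * lcmSum p L a b c) := by
  have hT := p_mul_boxSum_teichOn (p := p) (by omega) hpL ha hb hc
  rw [← teichLcmSum] at hT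
  have hE : weightedCubeSum p = -1 := by
    subst hp
    have h := teichInv_neg (p := 3) (by norm_num) 1
    rw [map_one, show (-1 : ZMod 3) = 2 from rfl] at h
    simp [weightedCubeSum, sum_range_succ, h]
    norm_num
  have hJ : teichJacobi p = -1 := by
    subst hp
    have h := teichInv_neg (p := 3) (by norm_num) 1
    rw [map_one, show (-1 : ZMod 3) = 2 from rfl] at h
    rw [teichJacobi, ← sum_range_natCast_zmod 3 (fun s => teichInv 3 s * teichInv 3 (1 + s))]
    have e1 : (1 + 1 : ZMod 3) = 2 := rfl
    have e2 : (1 + 2 : ZMod 3) = 0 := rfl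
    simp [sum_range_succ, h, e1, e2]
  have h3 : (p : ℤ_[p]) = 3 := by exact_mod_cast congrArg (Nat.cast (R := ℤ_[p])) hp
  obtain ⟨t, ht⟩ := dvd_recipSum_sub_boxSum_teichOn (p := p) a b c (p * L) (p * L)
  rw [hE, hJ, h3] at hT
  rw [h3] at ht
  have hd : ∀ {a b c}, a ∣ L → b ∣ L → c ∣ L → ¬ p ∣ a.lcm (b.gcd c) := fun ha hb _ h =>
    hpL (h.trans (Nat.lcm_dvd ha ((Nat.gcd_dvd_left _ _).trans hb)))
  obtain ⟨u, hu⟩ := nine_dvd_mul_teichInv_add hp (hd ha hb hc)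
  obtain ⟨v, hv⟩ := nine_dvd_mul_teichInv_add hp (hd hb hc ha)
  obtain ⟨w, hw⟩ := nine_dvd_mul_teichInv_add hp (hd hc ha hb)
  have m1 := congrArg (Nat.cast (R := ℤ_[p])) (mul_mul_div_lcm (a := a) hb hc)
  have m2 := congrArg (Nat.cast (R := ℤ_[p])) (mul_mul_div_lcm (a := b) hc ha)
  have m3 := congrArg (Nat.cast (R := ℤ_[p])) (mul_mul_div_lcm (a := c) ha hb)
  have g2 : b.gcd (c.gcd a) = a.gcd (b.gcd c) := by
    rw [← Nat.gcd_assoc, Nat.gcd_comm]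
  have g3 : c.gcd (a.gcd b) = a.gcd (b.gcd c) := by
    rw [Nat.gcd_comm, Nat.gcd_assoc]
  rw [g2] at m2
  rw [g3] at m3
  push_cast at m1 m2 m3 ⊢
  set g := a.gcd (b.gcd c)
  refine ⟨a * b * c * t + L * g * (u + v + w + 1), ?_⟩
  rw [teichLcmSum] at hT
  rw [lcmSum]
  linear_combination (3 * (a * b * c : ℤ_[p])) * ht + (a * b * c : ℤ_[p]) * hT
    + (teichInv p (a.lcm (b.gcd c) : ℕ) ^ 3 + 2 * recip p (a.lcm (b.gcd c)) ^ 3) * m1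
    + (teichInv p (b.lcm (c.gcd a) : ℕ) ^ 3 + 2 * recip p (b.lcm (c.gcd a)) ^ 3) * m2
    + (teichInv p (c.lcm (a.gcd b) : ℕ) ^ 3 + 2 * recip p (c.lcm (a.gcd b)) ^ 3) * m3
    + L * g * (hu + hv + hw)

/-! ### Passage between rational and p-adic statements -/

theorem pIntegral_iff_norm_le_one {p : ℕ} [Fact p.Prime] {q : ℚ} :
    PIntegral p q ↔ ‖(q : ℚ_[p])‖ ≤ 1 :=
  ⟨fun h => Padic.norm_rat_le_one h, fun h => isUnit_natCast_iff.1 (PadicInt.isUnit_den q h)⟩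

theorem pCongr_of_padicInt {p : ℕ} [Fact p.Prime] {r : ℕ} {x y : ℚ} {s t : ℤ_[p]}
    (hx : (x : ℚ_[p]) = s) (hxy : (x : ℚ_[p]) - y = (p : ℚ_[p]) ^ r * t) : PCongr p r x y := by
  have hp : (p : ℚ) ^ r ≠ 0 := pow_ne_zero _ (Nat.cast_ne_zero.2 (Fact.out : p.Prime).ne_zero)
  have hp' : (p : ℚ_[p]) ^ r ≠ 0 :=
    pow_ne_zero _ (Nat.cast_ne_zero.2 (Fact.out : p.Prime).ne_zero)
  have hy : (y : ℚ_[p]) = ((s - p ^ r * t : ℤ_[p]) : ℚ_[p]) := by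
    push_cast
    linear_combination hx - hxy
  refine ⟨?_, ?_, (x - y) / p ^ r, ?_, (mul_div_cancel₀ _ hp).symm⟩
  · rw [pIntegral_iff_norm_le_one, hx]
    exact s.norm_le_one
  · rw [pIntegral_iff_norm_le_one, hy]
    exact PadicInt.norm_le_one _
  · rw [pIntegral_iff_norm_le_one]
    have : (((x - y) / p ^ r : ℚ) : ℚ_[p]) = t := by
      push_cast
      rw [hxy, mul_div_cancel_left₀ _ hp']
    rw [this]
    exact t.norm_le_one

variable {p : ℕ} [Fact p.Prime] {a b c : ℕ}

theorem reciprocalSum_eq (ha : 0 < a) (hb : 0 < b) (hc : 0 < c)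
    (hpa : ¬ p ∣ a) (hpb : ¬ p ∣ b) (hpc : ¬ p ∣ c) (N : ℕ) :
    (reciprocalSum a b c N p : ℚ_[p])
      = (((a * b * c : ℕ) * recipSum p a b c N N : ℤ_[p]) : ℚ_[p]) := by
  have hprime : p.Prime := Fact.out
  have e1 : recipSum p a b c N N
      = ∑ t ∈ (range N ×ˢ range N ×ˢ range N).filter (fun t => t.1 + t.2.1 + t.2.2 = N),
        recipOn p a t.1 * recipOn p b t.2.1 * recipOn p c t.2.2 := by
    rw [recipSum, boxSum, sum_filter, sum_product]
    refine sum_congr rfl fun x _ => ?_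
    rw [sum_product]
  have hgcd : ∀ i j k : ℕ, Nat.gcd (i * j * k) p = 1 ↔ ¬ p ∣ i ∧ ¬ p ∣ j ∧ ¬ p ∣ k := by
    intro i j k
    rw [Nat.gcd_comm, ← Nat.coprime_iff_gcd_eq_one, hprime.coprime_iff_not_dvd, hprime.dvd_mul,
      hprime.dvd_mul]
    tauto
  have e2 : recipSum p a b c N N = ∑ t ∈ solutions a b c N p,
      recip p (a * t.1) * recip p (b * t.2.1) * recip p (c * t.2.2) := by
    rw [e1]
    symm
    refine sum_of_injOn (fun t => (a * t.1, b * t.2.1, c * t.2.2)) ?_ ?_ ?_ ?_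
    · rintro ⟨i, j, k⟩ - ⟨i', j', k'⟩ - h
      simpa [ha.ne', hb.ne', hc.ne'] using h
    · rintro ⟨i, j, k⟩ h
      obtain ⟨hi, hj, hk, -, hN⟩ := (mem_solutions ha hb hc i j k).1 h
      have := Nat.mul_pos ha hi
      have := Nat.mul_pos hb hj
      have := Nat.mul_pos hc hk
      simp only [coe_filter, mem_product, mem_range, Set.mem_ofPred_eq]
      omega
    · rintro ⟨x, y, z⟩ h hne
      simp only [mem_filter, mem_product, mem_range] at h
      by_contra h0
      apply hne
      have hx : a ∣ x ∧ ¬ p ∣ x := by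
        refine ⟨by_contra fun h => h0 (by simp [recipOn, h]), fun h => h0 ?_⟩
        simp [recipOn, recip_of_dvd h]
      have hy : b ∣ y ∧ ¬ p ∣ y := by
        refine ⟨by_contra fun h => h0 (by simp [recipOn, h]), fun h => h0 ?_⟩
        simp [recipOn, recip_of_dvd h]
      have hz : c ∣ z ∧ ¬ p ∣ z := by
        refine ⟨by_contra fun h => h0 (by simp [recipOn, h]), fun h => h0 ?_⟩
        simp [recipOn, recip_of_dvd h]
      obtain ⟨⟨i, rfl⟩, hi⟩ := hx
      obtain ⟨⟨j, rfl⟩, hj⟩ := hy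
      obtain ⟨⟨k, rfl⟩, hk⟩ := hz
      have hpos : ∀ {a i : ℕ}, ¬ p ∣ a * i → 1 ≤ i := fun h =>
        Nat.pos_of_ne_zero fun h' => h (by simp [h'])
      have hnd : ∀ {a i : ℕ}, ¬ p ∣ a * i → ¬ p ∣ i := fun h h' => h (h'.mul_left _)
      exact ⟨(i, j, k), (mem_solutions ha hb hc i j k).2 ⟨hpos hi, hpos hj, hpos hk,
        (hgcd i j k).2 ⟨hnd hi, hnd hj, hnd hk⟩, h.2⟩, rfl⟩
    · rintro ⟨i, j, k⟩ -
      simp [recipOn]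
  rw [e2, reciprocalSum, mul_sum, PadicInt.coe_sum]
  push_cast
  refine sum_congr rfl ?_
  rintro ⟨i, j, k⟩ h
  obtain ⟨hi0, hj0, hk0, hg, -⟩ := (mem_solutions ha hb hc i j k).1 h
  obtain ⟨hi, hj, hk⟩ := (hgcd i j k).1 hg
  have hmul : ∀ {a i : ℕ}, ¬ p ∣ a → ¬ p ∣ i → ¬ p ∣ a * i := fun h h' h'' =>
    (hprime.dvd_mul.1 h'').elim h h'
  rw [coe_recip (hmul hpa hi), coe_recip (hmul hpb hj), coe_recip (hmul hpc hk)]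
  have a0 : (a : ℚ_[p]) ≠ 0 := Nat.cast_ne_zero.2 ha.ne'
  have b0 : (b : ℚ_[p]) ≠ 0 := Nat.cast_ne_zero.2 hb.ne'
  have c0 : (c : ℚ_[p]) ≠ 0 := Nat.cast_ne_zero.2 hc.ne'
  push_cast
  have i0 : (i : ℚ_[p]) ≠ 0 := Nat.cast_ne_zero.2 (by omega)
  have j0 : (j : ℚ_[p]) ≠ 0 := Nat.cast_ne_zero.2 (by omega)
  have k0 : (k : ℚ_[p]) ≠ 0 := Nat.cast_ne_zero.2 (by omega)
  field_simp

theorem exists_padicInt_bernoulli :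
    ∃ B : ℤ_[p], (B : ℚ_[p]) = (bernoulli (p - 3) : ℚ) :=
  ⟨⟨_, bernoulli_mem_subring (p := p) (k := p - 3) (by
    have := (Fact.out : p.Prime).two_le
    omega)⟩, rfl⟩

/-- The modulus 3p allows a later division by 3 even when p = 3; for p > 3 the factor 3 is a unit.
-/
theorem three_mul_p_dvd_mul_recipSum_add (hp : p ≠ 2) {B : ℤ_[p]}
    (hB : (B : ℚ_[p]) = (bernoulli (p - 3) : ℚ)) {L : ℕ}
    (hpL : ¬ p ∣ L) (ha : a ∣ L) (hb : b ∣ L) (hc : c ∣ L) :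
    (3 * p : ℤ_[p]) ∣ (a * b * c : ℕ) *
      (3 * recipSum p a b c (p * L) (p * L) + 2 * B * lcmSum p L a b c) := by
  have hprime : p.Prime := Fact.out
  have h2 := hprime.two_le
  by_cases h3 : p = 3
  · have hB1 : B = 1 := by
      refine PadicInt.ext ?_
      rw [hB, show p - 3 = 0 by omega]
      simp
    have h3' : (p : ℤ_[p]) = 3 := by exact_mod_cast congrArg (Nat.cast (R := ℤ_[p])) h3
    rw [hB1, mul_one, h3', show (3 * 3 : ℤ_[p]) = 9 by norm_num]
    exact nine_dvd_mul_recipSum_add h3 hpL ha hb hc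
  · have h4 : p ≠ 4 := fun h => by
      rw [h] at hprime
      exact absurd hprime (by norm_num)
    have hu : IsUnit (3 : ℤ_[p]) := by
      have := (isUnit_natCast_iff (p := p) (n := 3)).2
        (Nat.not_dvd_of_pos_of_lt three_pos (by omega))
      exact_mod_cast this
    rw [hu.mul_left_dvd]
    exact (dvd_three_mul_recipSum_add (k := p - 4) (by omega) (by omega) hB hpL ha hb hc).mul_left _

/-- With d = lcm(a, g₁), the left side is Lgd/d³ = Lg/d², and dg = ag₁. -/
theorem lcmSum_term {L : ℕ} (ha : 0 < a) (hb0 : 0 < b) (hpL : ¬ p ∣ L)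
    (haL : a ∣ L) (hb : b ∣ L) (hc : c ∣ L) {g g₁ : ℕ} (hg : g = a.gcd (b.gcd c))
    (hg₁ : g₁ = b.gcd c) :
    (a * b * c : ℚ_[p]) * ((L / b.lcm c : ℕ) * (recip p (a.lcm (b.gcd c)) : ℚ_[p]) ^ 3)
      = L * (g : ℚ_[p]) ^ 3 * (1 / ((a : ℚ_[p]) ^ 2 * (g₁ : ℚ_[p]) ^ 2)) := by
  have hpd : ¬ p ∣ a.lcm (b.gcd c) := fun h =>
    hpL (h.trans (Nat.lcm_dvd haL ((Nat.gcd_dvd_left _ _).trans hb)))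
  have h1 := congrArg (Nat.cast (R := ℚ_[p])) (mul_mul_div_lcm (a := a) hb hc)
  have h2 := congrArg (Nat.cast (R := ℚ_[p])) (lcm_mul_gcd_gcd a b c)
  have hg₁0 : 0 < b.gcd c := Nat.gcd_pos_of_pos_left _ hb0
  have d0 : ((a.lcm (b.gcd c) : ℕ) : ℚ_[p]) ≠ 0 := Nat.cast_ne_zero.2 (Nat.lcm_pos ha hg₁0).ne'
  have a0 : (a : ℚ_[p]) ≠ 0 := Nat.cast_ne_zero.2 ha.ne'
  have g0 : (g₁ : ℚ_[p]) ≠ 0 := Nat.cast_ne_zero.2 (hg₁ ▸ hg₁0.ne')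
  rw [← hg] at h1 h2
  rw [coe_recip hpd]
  push_cast at h1 h2
  rw [← mul_assoc, h1]
  set d : ℚ_[p] := ((a.lcm (b.gcd c) : ℕ) : ℚ_[p])
  rw [← hg₁] at h2
  field_simp
  linear_combination (-(L * g) * (d * g + a * g₁) : ℚ_[p]) * h2

end WeightedTripleSum

theorem theorem2 (a₁ a₂ a₃ A : ℕ) (ha₁ : 0 < a₁) (ha₂ : 0 < a₂) (ha₃ : 0 < a₃) (hA : 0 < A)
    (hA₁ : a₁ ∣ A) (hA₂ : a₂ ∣ A) (hA₃ : a₃ ∣ A)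
    (g₁ g₂ g₃ g : ℕ) (hg₁ : g₁ = Nat.gcd a₂ a₃) (hg₂ : g₂ = Nat.gcd a₃ a₁)
    (hg₃ : g₃ = Nat.gcd a₁ a₂) (hg : g = Nat.gcd a₁ (Nat.gcd a₂ a₃))
    (p : ℕ) (hp : p.Prime) (hp_odd : Odd p)
    (hp₁ : ¬ p ∣ a₁) (hp₂ : ¬ p ∣ a₂) (hp₃ : ¬ p ∣ a₃)
    (r : ℕ) (hr : 0 < r) :
    PCongr p r (reciprocalSum a₁ a₂ a₃ (A * p ^ r) p)
      (-2 * (p : ℚ) ^ (r - 1) * bernoulli (p - 3) * ((A : ℚ) * (g : ℚ) ^ 3 / 3) *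
        (1 / ((a₁ : ℚ) ^ 2 * (g₁ : ℚ) ^ 2) + 1 / ((a₂ : ℚ) ^ 2 * (g₂ : ℚ) ^ 2)
          + 1 / ((a₃ : ℚ) ^ 2 * (g₃ : ℚ) ^ 2))) := by
  have : Fact p.Prime := ⟨hp⟩
  have hp2 : p ≠ 2 := by
    rintro rfl
    exact absurd hp_odd (by decide)
  obtain ⟨m, hm⟩ : a₁.lcm (a₂.lcm a₃) ∣ A := Nat.lcm_dvd hA₁ (Nat.lcm_dvd hA₂ hA₃)
  set L := a₁.lcm (a₂.lcm a₃) with hL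
  have hL₁ : a₁ ∣ L := Nat.dvd_lcm_left _ _
  have hL₂ : a₂ ∣ L := (Nat.dvd_lcm_left _ _).trans (Nat.dvd_lcm_right _ _)
  have hL₃ : a₃ ∣ L := (Nat.dvd_lcm_right _ _).trans (Nat.dvd_lcm_right _ _)
  have hpL : ¬ p ∣ L := by
    intro h
    have h1 : L ∣ a₁ * (a₂ * a₃) := (Nat.lcm_dvd_mul _ _).trans
      (mul_dvd_mul_left _ (Nat.lcm_dvd_mul _ _))
    rcases hp.dvd_mul.1 (h.trans h1) with h | h
    · exact hp₁ h
    · exact (hp.dvd_mul.1 h).elim hp₂ hp₃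
  have hm0 : 0 < m := Nat.pos_of_ne_zero fun h => by simp [h] at hm; omega
  obtain ⟨s, rfl⟩ : ∃ s, r = s + 1 := ⟨r - 1, by omega⟩
  have hN : A * p ^ (s + 1) = m * (p ^ s * (p * L)) := by rw [hm]; ring
  have hS := WeightedTripleSum.reciprocalSum_eq ha₁ ha₂ ha₃ hp₁ hp₂ hp₃ (A * p ^ (s + 1))
  have hpN : p ∣ p * L := Dvd.intro _ rfl
  obtain ⟨B, hB⟩ := WeightedTripleSum.exists_padicInt_bernoulli (p := p)
  obtain ⟨y, hy⟩ := WeightedTripleSum.three_mul_p_dvd_mul_recipSum_add hp2 hB hpL hL₁ hL₂ hL₃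
  obtain ⟨w, hw⟩ := WeightedTripleSum.dvd_recipSum_prime_pow_mul_sub hp2 (hL₁.mul_left p)
    (hL₂.mul_left p) (hL₃.mul_left p) hpN s
  obtain ⟨v, hv⟩ := WeightedTripleSum.dvd_recipSum_nat_mul_sub ((hL₁.mul_left p).mul_left (p ^ s))
    ((hL₂.mul_left p).mul_left (p ^ s)) ((hL₃.mul_left p).mul_left (p ^ s))
    (hpN.mul_left (p ^ s)) hm0
  have hg2 : g = a₂.gcd (a₃.gcd a₁) := by rw [hg, ← Nat.gcd_assoc a₂, Nat.gcd_comm]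
  have hg3 : g = a₃.gcd (a₁.gcd a₂) := by rw [hg, Nat.gcd_comm a₃, Nat.gcd_assoc]
  have t1 := WeightedTripleSum.lcmSum_term ha₁ ha₂ hpL hL₁ hL₂ hL₃ hg hg₁
  have t2 := WeightedTripleSum.lcmSum_term ha₂ ha₃ hpL hL₂ hL₃ hL₁ hg2 hg₂
  have t3 := WeightedTripleSum.lcmSum_term ha₃ ha₁ hpL hL₃ hL₁ hL₂ hg3 hg₃
  rw [hN] at hS ⊢
  -- The three parts of the quotient by p^(s+1): y from the base congruence, v from the dilation by
  -- m, w from the dilation by p^s.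
  refine WeightedTripleSum.pCongr_of_padicInt
    (t := m * y + (a₁ * a₂ * a₃ : ℕ) * (L * v + m * w)) hS ?_
  rw [hS]
  have hy' := congrArg (fun x : ℤ_[p] => (x : ℚ_[p])) hy
  have hw' := congrArg (fun x : ℤ_[p] => (x : ℚ_[p])) hw
  have hv' := congrArg (fun x : ℤ_[p] => (x : ℚ_[p])) hv
  simp only [WeightedTripleSum.lcmSum] at hy'
  rw [Nat.add_sub_cancel, hm]
  push_cast at hy' hw' hv' ⊢
  have c2 : ((2 : ℤ_[p]) : ℚ_[p]) = 2 := PadicInt.coe_natCast 2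
  have c3 : ((3 : ℤ_[p]) : ℚ_[p]) = 3 := PadicInt.coe_natCast 3
  rw [hB, c2, c3] at hy'
  linear_combination (a₁ * a₂ * a₃ : ℚ_[p]) * hv' + (a₁ * a₂ * a₃ * m : ℚ_[p]) * hw'
    + (m * p ^ s / 3 : ℚ_[p]) * hy'
    - (2 / 3 * m * p ^ s * (bernoulli (p - 3) : ℚ) : ℚ_[p]) * (t1 + t2 + t3)
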